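/- Conventions. Hilbert spaces are complex and operators are bounded; $[S,T]=ST-TS$. The tetrablock is $\mathbb E=\{(x_1,x_2,x_3)\in\mathbb C^3: 1-zx_1-wx_2+zwx_3\neq 0 \text{ whenever } |z|\le 1,\ |w|\le 1\}$, with distinguished boundary $b\overline{\mathbb E}=\{(x_1,x_2,x_3): x_1=\overline{x_2}\,x_3,\ |x_2|\le 1,\ |x_3|=1\}$. A commuting triple of normal operators whose Taylor joint spectrum lies in $b\overline{\mathbb E}$ is an $\mathbb E$-unitary. A commuting triple $(T_1,T_2,T_3)$ on $\mathcal H$ is an $\mathbb E$-isometry if there are a Hilbert space $\mathcal K\supseteq\mathcal H$ and an $\mathbb E$-unitary $(N_1,N_2,N_3)$ on $\mathcal K$ that leaves $\mathcal H$ invariant with $T_i=N_i|_{\mathcal H}$ for $i=1,2,3$; it is pure if $T_3$ is a pure isometry, i.e. an isometry with $T_3^{*n}\to 0$ strongly; it is an $\mathbb E$-co-isometry if $(T_1^*,T_2^*,T_3^*)$ is an $\mathbb E$-isometry. For a contraction $T$ put $D_T=(I-T^*T)^{1/2}$ and $\mathcal D_T=\overline{\operatorname{Ran}}\,D_T$.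 Fundamental operators of $(T_1,T_2,T_3)$ are bounded operators $A_1,A_2$ on $\mathcal D_{T_3}$ with $T_1-T_2^*T_3=D_{T_3}A_1D_{T_3}$ and $T_2-T_1^*T_3=D_{T_3}A_2D_{T_3}$. For a Hilbert space $E$, $H^2(E)$ is the closed subspace of $L^2(\mathbb T;E)$ of functions whose Fourier coefficients of negative index vanish, and for a continuous $\varphi:\mathbb T\to\mathcal L(E)$ the Toeplitz operator $T_\varphi$ on $H^2(E)$ is multiplication by $\varphi$ followed by the orthogonal projection onto $H^2(E)$. **Theorem 3.3.** Let $(\hat T_1,\hat T_2,\hat T_3)$ be a pure $\mathbb E$-isometry on a Hilbert space $\mathcal H$. Then the $\mathbb E$-co-isometry $(\hat T_1^*,\hat T_2^*,\hat T_3^*)$ has exactly one pair of fundamental operators $A_1,A_2\in\mathcal L(\mathcal D_{\hat T_3^*})$, and there is a unitary $U:\mathcal H\to H^2(\mathcal D_{\hat T_3^*})$, mapping each $x\in\mathcal D_{\hat T_3^*}$ to the constant function $x$, such that $$\hat T_1=U^*T_{A_1^*+A_2z}U,\qquad \hat T_2=U^*T_{A_2^*+A_1z}U,\qquad \hat T_3=U^*T_zU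 .$$ Moreover, 1. $[A_1,A_2]=0$; 2. $[A_1^*,A_1]=[A_2^*,A_2]$; 3. $\|A_1^*+A_2z\|\le 1$ for all $z\in\mathbb C$ with $|z|<1$. Conversely, if $A_1,A_2$ are bounded operators on a Hilbert space $E$ satisfying 1, 2 and 3, then $(T_{A_1^*+A_2z},T_{A_2^*+A_1z},T_z)$ on $H^2(E)$ is a pure $\mathbb E$-isometry. -/

import Mathlib

open scoped ComplexConjugate InnerProduct ENNReal
open MeasureTheory Filter Topology

universe u

noncomputable section

namespace Tetrablock

/-! ### The Taylor joint spectrum of a triple of operators -/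

section Taylor

variable {H : Type u} [NormedAddCommGroup H] [InnerProductSpace ℂ H]

/-- The first map `H → H³` of the Koszul complex of a triple of operators. -/
def koszul₀ (T₁ T₂ T₃ : H →L[ℂ] H) (x : H) : H × H × H :=
  (T₁ x, T₂ x, T₃ x)

/-- The second map `H³ → H³` of the Koszul complex of a triple of operators. -/
def koszul₁ (T₁ T₂ T₃ : H →L[ℂ] H) (x : H × H × H) : H × H × H :=
  (T₂ x.2.2 - T₃ x.2.1, T₃ x.1 - T₁ x.2.2, T₁ x.2.1 - T₂ x.1)

/-- The third map `H³ → H` of the Koszul complex of a triple of operators. -/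
def koszul₂ (T₁ T₂ T₃ : H →L[ℂ] H) (x : H × H × H) : H :=
  T₁ x.1 + T₂ x.2.1 + T₃ x.2.2

/-- A triple is Taylor regular if its Koszul complex `0 → H → H³ → H³ → H → 0` is exact. -/
def TaylorRegular (T₁ T₂ T₃ : H →L[ℂ] H) : Prop :=
  Function.Injective (koszul₀ T₁ T₂ T₃) ∧
    Function.Exact (koszul₀ T₁ T₂ T₃) (koszul₁ T₁ T₂ T₃) ∧
    Function.Exact (koszul₁ T₁ T₂ T₃) (koszul₂ T₁ T₂ T₃) ∧
    Function.Surjective (koszul₂ T₁ T₂ T₃)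

/-- The Taylor joint spectrum of a (commuting) triple: the points `(l₁, l₂, l₃)` of `ℂ³` such that
`(T₁ - l₁, T₂ - l₂, T₃ - l₃)` is not Taylor regular. -/
def taylorSpectrum (T₁ T₂ T₃ : H →L[ℂ] H) : Set (ℂ × ℂ × ℂ) :=
  {l | ¬ TaylorRegular (T₁ - l.1 • ContinuousLinearMap.id ℂ H)
    (T₂ - l.2.1 • ContinuousLinearMap.id ℂ H) (T₃ - l.2.2 • ContinuousLinearMap.id ℂ H)}

end Taylor

/-! ### Unitaries and isometries associated with the tetrablock -/

/-- The tetrablock `𝔼`. -/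
def tetrablock : Set (ℂ × ℂ × ℂ) :=
  {x | ∀ z w : ℂ, ‖z‖ ≤ 1 → ‖w‖ ≤ 1 → 1 - z * x.1 - w * x.2.1 + z * w * x.2.2 ≠ 0}

/-- The distinguished boundary of the closed tetrablock:
`{(x₁, x₂, x₃) : x₁ = conj x₂ * x₃, |x₂| ≤ 1, |x₃| = 1}`. -/
def distinguishedBoundary : Set (ℂ × ℂ × ℂ) :=
  {x | x.1 = conj x.2.1 * x.2.2 ∧ ‖x.2.1‖ ≤ 1 ∧ ‖x.2.2‖ = 1}

theorem norm_le_of_ne {a b : ℂ} (h : ∀ w : ℂ, ‖w‖ ≤ 1 → a - w * b ≠ 0) : ‖b‖ ≤ ‖a‖ := by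
  by_contra! hlt
  have hb : b ≠ 0 := by
    rintro rfl
    exact absurd hlt (by simp)
  refine h (a / b) ?_ (by field_simp; simp)
  rw [norm_div]
  exact div_le_one_of_le₀ hlt.le (norm_nonneg _)

/-- The distinguished boundary consists of the points of the closed tetrablock with `|x₃| = 1`. -/
theorem distinguishedBoundary_eq :
    distinguishedBoundary = {x | x ∈ closure tetrablock ∧ ‖x.2.2‖ = 1} := by
  ext ⟨a, b, c⟩
  constructor
  · rintro ⟨h1, h2, h3⟩
    simp only at h1 h2 h3
    refine ⟨?_, h3⟩
    have key : ∀ r : ℝ, r ∈ Set.Ioo (0 : ℝ) 1 →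
        ((r * a, r * b, (r : ℂ) ^ 2 * c) : ℂ × ℂ × ℂ) ∈ tetrablock := by
      intro r hr z w hz hw h0
      simp only at h0
      have hz' : ‖(r : ℂ) * z‖ < 1 := by
        rw [norm_mul, Complex.norm_real, Real.norm_of_nonneg hr.1.le]
        nlinarith [norm_nonneg z, hr.1, hr.2]
      have hw' : ‖(r : ℂ) * w‖ < 1 := by
        rw [norm_mul, Complex.norm_real, Real.norm_of_nonneg hr.1.le]
        nlinarith [norm_nonneg w, hr.1, hr.2]
      set p := (r : ℂ) * z
      set q := (r : ℂ) * w
      have h5 : 1 - q * b = p * c * (conj b - q) := by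
        rw [h1] at h0
        simp only [p, q]
        linear_combination h0
      have h6 : ‖conj b - q‖ ≤ ‖1 - q * b‖ := by
        rw [← sq_le_sq₀ (norm_nonneg _) (norm_nonneg _), ← Complex.normSq_eq_norm_sq,
          ← Complex.normSq_eq_norm_sq]
        have hb2 : Complex.normSq b ≤ 1 := by
          rw [Complex.normSq_eq_norm_sq]; nlinarith [norm_nonneg b]
        have hq2 : Complex.normSq q ≤ 1 := by
          rw [Complex.normSq_eq_norm_sq]; nlinarith [norm_nonneg q]
        simp only [Complex.normSq_apply, Complex.sub_re, Complex.sub_im, Complex.conj_re,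
          Complex.conj_im, Complex.mul_re, Complex.mul_im, Complex.one_re, Complex.one_im] at *
        nlinarith [mul_nonneg (sub_nonneg.2 hb2) (sub_nonneg.2 hq2)]
      have h7 : 0 < ‖1 - q * b‖ := by
        rw [norm_pos_iff, sub_ne_zero]
        intro h
        have : ‖q * b‖ = 1 := by rw [← h]; simp
        rw [norm_mul] at this
        nlinarith [norm_nonneg q, norm_nonneg b]
      have h8 : ‖1 - q * b‖ = ‖p‖ * ‖conj b - q‖ := by
        rw [h5, norm_mul, norm_mul, h3, mul_one]
      nlinarith [norm_nonneg p, norm_nonneg (conj b - q)]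
    have hlim : Tendsto (fun r : ℝ => ((r * a, r * b, (r : ℂ) ^ 2 * c) : ℂ × ℂ × ℂ))
        (𝓝[<] 1) (𝓝 (a, b, c)) := by
      have hc : Continuous (fun r : ℝ => ((r * a, r * b, (r : ℂ) ^ 2 * c) : ℂ × ℂ × ℂ)) := by
        fun_prop
      simpa using (hc.tendsto 1).mono_left nhdsWithin_le_nhds
    exact mem_closure_of_tendsto hlim
      (Filter.mem_of_superset (Ioo_mem_nhdsLT (by norm_num : (0 : ℝ) < 1)) key)
  · rintro ⟨hx, h3⟩
    simp only at h3
    have hcl : closure tetrablock ⊆ {x : ℂ × ℂ × ℂ | ∀ z : ℂ, ‖z‖ ≤ 1 →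
        ‖x.2.1 - z * x.2.2‖ ≤ ‖1 - z * x.1‖ ∧ ‖x.1 - z * x.2.2‖ ≤ ‖1 - z * x.2.1‖} := by
      refine closure_minimal (fun x hx z hz => ⟨?_, ?_⟩) ?_
      · refine norm_le_of_ne fun w hw h => hx z w hz hw ?_
        linear_combination h
      · refine norm_le_of_ne fun w hw h => hx w z hw hz ?_
        linear_combination h
      · simp only [Set.ofPred_forall]
        refine isClosed_iInter fun z => isClosed_iInter fun _ => ?_
        rw [Set.ofPred_and]
        exact (isClosed_le (by fun_prop) (by fun_prop)).inter
          (isClosed_le (by fun_prop) (by fun_prop))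
    have h := hcl hx
    simp only [Set.mem_ofPred_eq] at h
    have h2 : ‖b‖ ≤ 1 := by simpa using (h 0 (by simp)).1
    refine ⟨?_, h2, h3⟩
    simp only
    have hc1 : Complex.normSq c = 1 := by rw [Complex.normSq_eq_norm_sq, h3]; norm_num
    have e : ∀ z : ℂ, ‖z‖ = 1 →
        Complex.normSq b - 2 * (z * (c * conj b)).re ≤ Complex.normSq a - 2 * (z * a).re ∧
        Complex.normSq a - 2 * (z * (c * conj a)).re ≤ Complex.normSq b - 2 * (z * b).re := by
      intro z hz
      have hz1 : Complex.normSq z = 1 := by rw [Complex.normSq_eq_norm_sq, hz]; norm_num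
      obtain ⟨u, v⟩ := h z hz.le
      rw [← sq_le_sq₀ (norm_nonneg _) (norm_nonneg _), ← Complex.normSq_eq_norm_sq,
        ← Complex.normSq_eq_norm_sq, Complex.normSq_sub, Complex.normSq_sub, Complex.normSq_mul,
        Complex.normSq_mul, hz1, hc1] at u v
      simp only [map_mul, map_one, Complex.mul_re, Complex.conj_re, Complex.conj_im,
        Complex.mul_im, Complex.one_re, Complex.one_im] at *
      constructor <;> nlinarith
    have e0 := e 1 (by simp)
    have e1 := e (-1) (by simp)
    simp only [neg_mul, one_mul, Complex.neg_re] at e0 e1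
    have hab : Complex.normSq a = Complex.normSq b := by linarith [e0.1, e0.2, e1.1, e1.2]
    by_contra hne
    set y := a - conj b * c with hy
    have hy0 : y ≠ 0 := sub_ne_zero.2 hne
    have hny : (‖y‖ : ℂ) ≠ 0 := by simpa using hy0
    have f := (e (conj y / ‖y‖) (by simp [hy0])).1
    have g : conj y / ‖y‖ * a = conj y / ‖y‖ * (c * conj b) + ‖y‖ := by
      have := Complex.conj_mul' y
      field_simp
      rw [← this, hy]
      ring
    rw [g, Complex.add_re, Complex.ofReal_re] at f
    linarith [norm_pos_iff.2 hy0]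

section Operators

variable {H : Type u} [NormedAddCommGroup H] [InnerProductSpace ℂ H]

/-- The three operators commute pairwise. -/
structure CommutingTriple (T₁ T₂ T₃ : H →L[ℂ] H) : Prop where
  comm₁₂ : T₁ * T₂ = T₂ * T₁
  comm₁₃ : T₁ * T₃ = T₃ * T₁
  comm₂₃ : T₂ * T₃ = T₃ * T₂

variable [CompleteSpace H]

/-- `𝔼`-unitaries: commuting normal operators whose joint spectrum lies in the distinguished
boundary. -/
structure IsEUnitary (N₁ N₂ N₃ : H →L[ℂ] H) : Prop where
  commuting : CommutingTriple N₁ N₂ N₃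
  normal₁ : IsStarNormal N₁
  normal₂ : IsStarNormal N₂
  normal₃ : IsStarNormal N₃
  spectrum_subset : taylorSpectrum N₁ N₂ N₃ ⊆ distinguishedBoundary

/-- `𝔼`-isometries: commuting triples that are the restriction of an `𝔼`-unitary to a common
invariant subspace. The containment of `H` in the larger Hilbert space `K` is given by a linear
isometry `J`. -/
def IsEIsometry (T₁ T₂ T₃ : H →L[ℂ] H) : Prop :=
  CommutingTriple T₁ T₂ T₃ ∧
    ∃ (K : Type u) (_ : NormedAddCommGroup K) (_ : InnerProductSpace ℂ K) (_ : CompleteSpace K)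
      (J : H →ₗᵢ[ℂ] K) (N₁ N₂ N₃ : K →L[ℂ] K),
      IsEUnitary N₁ N₂ N₃ ∧
        ∀ x, N₁ (J x) = J (T₁ x) ∧ N₂ (J x) = J (T₂ x) ∧ N₃ (J x) = J (T₃ x)

/-- Pure isometries: isometries `V` such that the powers of the adjoint of `V` tend strongly
to `0`. -/
def IsPureIsometry (V : H →L[ℂ] H) : Prop :=
  Isometry V ∧ ∀ x, Tendsto (fun n : ℕ => ((V†) ^ n) x) atTop (𝓝 0)

/-- Pure `𝔼`-isometries. -/
def IsPureEIsometry (T₁ T₂ T₃ : H →L[ℂ] H) : Prop :=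
  IsEIsometry T₁ T₂ T₃ ∧ IsPureIsometry T₃

/-! ### Defect spaces and fundamental operators -/

/-- The defect operator `D_T = (I - T* T)^{1/2}` (of a contraction `T`). -/
def defectOp (T : H →L[ℂ] H) : H →L[ℂ] H :=
  CFC.sqrt (1 - (T†) * T)

/-- The defect space `𝒟_T`, the closure of the range of `D_T`. -/
abbrev defectSpace (T : H →L[ℂ] H) : Submodule ℂ H :=
  (LinearMap.range (defectOp T : H →ₗ[ℂ] H)).topologicalClosure

/-- `D_T` as a map into the defect space. -/
def defectMap (T : H →L[ℂ] H) : H →L[ℂ] defectSpace T :=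
  (defectOp T).codRestrict (defectSpace T)
    fun x => Submodule.le_topologicalClosure _ (LinearMap.mem_range_self _ x)

/-- `A₁, A₂` are fundamental operators of `(T₁, T₂, T₃)`: bounded operators on the defect
space of `T₃` such that `T₁ - T₂* T₃ = D A₁ D` and `T₂ - T₁* T₃ = D A₂ D`, where `D = D_{T₃}`. -/
def AreFundamentalOperators (T₁ T₂ T₃ : H →L[ℂ] H)
    (A₁ A₂ : defectSpace T₃ →L[ℂ] defectSpace T₃) : Prop :=
  T₁ - (T₂†) ∘L T₃ = defectOp T₃ ∘L (defectSpace T₃).subtypeL ∘L A₁ ∘L defectMap T₃ ∧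
    T₂ - (T₁†) ∘L T₃ = defectOp T₃ ∘L (defectSpace T₃).subtypeL ∘L A₂ ∘L defectMap T₃

end Operators

/-! ### The vector-valued Hardy space and Toeplitz operators

The unit circle is parametrized by `ℝ / ℤ` through `z = fourier 1 t = exp (2 π i t)`, and carries
the normalized arc length measure. -/

section Hardy

variable (E : Type u) [NormedAddCommGroup E] [InnerProductSpace ℂ E]

/-- The space `L²(E)` of (classes of) square integrable `E`-valued functions on the circle. -/
abbrev LTwo : Type u :=
  Lp E 2 (AddCircle.haarAddCircle (T := (1 : ℝ)))

variable [CompleteSpace E]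

variable {E} in
theorem fourierCoeff_eq_lpPairing (f : LTwo E) (n : ℤ) :
    fourierCoeff (f : UnitAddCircle → E) n =
      (ContinuousLinearMap.lsmul ℂ ℂ : ℂ →L[ℂ] E →L[ℂ] E).lpPairing
        (AddCircle.haarAddCircle (T := (1 : ℝ))) 2 2 (fourierLp 2 (-n)) f := by
  rw [ContinuousLinearMap.lpPairing_eq_integral, fourierCoeff]
  refine integral_congr_ae ?_
  filter_upwards [coeFn_fourierLp (T := (1 : ℝ)) 2 (-n)] with t ht
  rw [ht, ContinuousLinearMap.lsmul_apply]

/-- The vector-valued Hardy space `H²(E)`: the functions in `L²(E)` whose Fourier coefficients of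
negative index vanish. -/
def hardySpace : Submodule ℂ (LTwo E) where
  carrier := {f | ∀ n : ℤ, n < 0 → fourierCoeff (f : UnitAddCircle → E) n = 0}
  zero_mem' n _ := by rw [fourierCoeff_eq_lpPairing, map_zero]
  add_mem' {f g} hf hg n hn := by
    rw [fourierCoeff_eq_lpPairing, map_add, ← fourierCoeff_eq_lpPairing,
      ← fourierCoeff_eq_lpPairing, hf n hn, hg n hn, add_zero]
  smul_mem' c f hf n hn := by
    rw [fourierCoeff_eq_lpPairing, map_smul, ← fourierCoeff_eq_lpPairing, hf n hn, smul_zero]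

theorem isClosed_hardySpace : IsClosed (hardySpace E : Set (LTwo E)) := by
  have h : (hardySpace E : Set (LTwo E)) =
      ⋂ n : ℤ, ⋂ _ : n < 0, {f | (ContinuousLinearMap.lsmul ℂ ℂ : ℂ →L[ℂ] E →L[ℂ] E).lpPairing
        (AddCircle.haarAddCircle (T := (1 : ℝ))) 2 2 (fourierLp 2 (-n)) f = 0} := by
    ext f
    simp only [Set.mem_iInter, Set.mem_ofPred_eq, ← fourierCoeff_eq_lpPairing]
    rfl
  rw [h]
  exact isClosed_iInter fun n => isClosed_iInter fun _ =>
    isClosed_eq (ContinuousLinearMap.continuous _) continuous_const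

instance : CompleteSpace (hardySpace E) :=
  (isClosed_hardySpace E).completeSpace_coe

variable {E}

/-- The multiplication operator `M_φ` on `L²(E)` with continuous operator-valued symbol `φ`, given
by `(M_φ f) t = φ t (f t)` for almost every `t`. -/
def multOp (φ : C(UnitAddCircle, E →L[ℂ] E)) : LTwo E →L[ℂ] LTwo E :=
  (ContinuousLinearMap.id ℂ (E →L[ℂ] E)).holderL
    (AddCircle.haarAddCircle (T := (1 : ℝ))) ∞ 2 2 (ContinuousMap.toLp ∞ _ ℂ φ)

/-- The Toeplitz operator `T_φ` on `H²(E)`: multiplication by `φ` followed by the orthogonal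
projection of `L²(E)` onto `H²(E)`. -/
def toeplitz (φ : C(UnitAddCircle, E →L[ℂ] E)) : hardySpace E →L[ℂ] hardySpace E :=
  (hardySpace E).orthogonalProjectionOnto ∘L multOp φ ∘L (hardySpace E).subtypeL

/-- The operator-valued function `z ↦ B + z C` on the unit circle. -/
def affineSymbol (B C : E →L[ℂ] E) : C(UnitAddCircle, E →L[ℂ] E) where
  toFun t := B + fourier 1 t • C
  continuous_toFun := by fun_prop

/-- `T_z`, the Toeplitz operator whose symbol is multiplication by the coordinate `z`. -/
def toeplitzZ : hardySpace E →L[ℂ] hardySpace E :=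
  toeplitz (affineSymbol 0 1)

end Hardy

end Tetrablock

end

/-!
The proof rests on three facts.

* A triple is an `𝔼`-unitary exactly when it commutes, `N₃` is unitary, `N₁ = N₂* N₃` and
  `‖N₂‖ ≤ 1` (`IsEUnitary.relations`, `isEUnitary_of_relations`). If the Koszul complex of
  `N - l` is exact, its last map is onto, so `∑ (Nᵢ - lᵢ)(Nᵢ - lᵢ)*` is invertible and no
  character of the commutative C*-algebra generated by the triple takes the value `l`; hence the
  relations hold under the Gelfand transform. Conversely, the relations make the column `N - l`
  bounded below for `l` outside the distinguished boundary, and its left inverse is a contracting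
  homotopy of the Koszul complex.

* Multiplication by `B + z C` on `L²(E)` leaves `H²(E)` invariant, so that Toeplitz operators with
  such symbols are restrictions. Conditions 1, 2 and 3 say that the symbols `A₁* + z A₂` and
  `A₂* + z A₁` commute on the circle and are contractive, and `A₁* + z A₂ = (A₂* + z A₁)* z` holds
  there in any case. This gives the converse part (`isPureEIsometry_toeplitz`).

* For an `𝔼`-isometry, compression of the relations gives `T₁ = T₂* V` and `T₂ = T₁* V` with the
  isometry `V = T₃`. The defect operator of `V*` is the projection `1 - V V*` onto the wandering
  space `ker V*`, and `T₁* - T₂ V* = T₁* (1 - V V*)`; so the fundamental operators are the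
  restrictions of `T₁*` and `T₂*` to `ker V*` (`areFundamentalOperators_iff`). It follows that `T₁`
  acts on `ker V*` as `A₁* + V A₂`. When `V` is pure, the space is the Hilbert sum of the
  subspaces `Vⁿ ker V*`, and `Vⁿ x ↦ zⁿ x` is the required unitary. Condition 1 is the commutation of `T₁*` and `T₂*`,
  condition 2 comes from `T₁* T₁ = T₂* T₂`, and condition 3 from the action of `T₁*` on the vectors
  `∑ aⁿ Vⁿ x`, the reproducing kernels of the model.
-/

namespace Tetrablock

open scoped InnerProductSpace

/-! ### `𝔼`-unitaries and their algebraic relations -/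

section Unitaries

variable {H : Type u} [NormedAddCommGroup H] [InnerProductSpace ℂ H]

/-- If `B₁ T₁ + B₂ T₂ + B₃ T₃ = 1` for operators `Bᵢ` that commute with the triple, then these
operators give a contracting homotopy of the Koszul complex. -/
theorem TaylorRegular.of_left_inverse {T₁ T₂ T₃ B₁ B₂ B₃ : H →L[ℂ] H}
    (hT : CommutingTriple T₁ T₂ T₃)
    (h₁₁ : B₁ * T₁ = T₁ * B₁) (h₁₂ : B₁ * T₂ = T₂ * B₁) (h₁₃ : B₁ * T₃ = T₃ * B₁)
    (h₂₁ : B₂ * T₁ = T₁ * B₂) (h₂₂ : B₂ * T₂ = T₂ * B₂) (h₂₃ : B₂ * T₃ = T₃ * B₂)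
    (h₃₁ : B₃ * T₁ = T₁ * B₃) (h₃₂ : B₃ * T₂ = T₂ * B₃) (h₃₃ : B₃ * T₃ = T₃ * B₃)
    (hB : B₁ * T₁ + B₂ * T₂ + B₃ * T₃ = 1) : TaylorRegular T₁ T₂ T₃ := by
  have c₁₂ (x : H) : T₁ (T₂ x) = T₂ (T₁ x) := DFunLike.congr_fun hT.comm₁₂ x
  have c₁₃ (x : H) : T₁ (T₃ x) = T₃ (T₁ x) := DFunLike.congr_fun hT.comm₁₃ x
  have c₂₃ (x : H) : T₂ (T₃ x) = T₃ (T₂ x) := DFunLike.congr_fun hT.comm₂₃ x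
  replace h₁₁ (x : H) : B₁ (T₁ x) = T₁ (B₁ x) := DFunLike.congr_fun h₁₁ x
  replace h₁₂ (x : H) : B₁ (T₂ x) = T₂ (B₁ x) := DFunLike.congr_fun h₁₂ x
  replace h₁₃ (x : H) : B₁ (T₃ x) = T₃ (B₁ x) := DFunLike.congr_fun h₁₃ x
  replace h₂₁ (x : H) : B₂ (T₁ x) = T₁ (B₂ x) := DFunLike.congr_fun h₂₁ x
  replace h₂₂ (x : H) : B₂ (T₂ x) = T₂ (B₂ x) := DFunLike.congr_fun h₂₂ x
  replace h₂₃ (x : H) : B₂ (T₃ x) = T₃ (B₂ x) := DFunLike.congr_fun h₂₃ x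
  replace h₃₁ (x : H) : B₃ (T₁ x) = T₁ (B₃ x) := DFunLike.congr_fun h₃₁ x
  replace h₃₂ (x : H) : B₃ (T₂ x) = T₂ (B₃ x) := DFunLike.congr_fun h₃₂ x
  replace h₃₃ (x : H) : B₃ (T₃ x) = T₃ (B₃ x) := DFunLike.congr_fun h₃₃ x
  replace hB (x : H) : T₁ (B₁ x) + T₂ (B₂ x) + T₃ (B₃ x) = x := by
    rw [← h₁₁, ← h₂₂, ← h₃₃]; exact DFunLike.congr_fun hB x
  refine ⟨fun x y h => ?_, fun ⟨x, y, z⟩ => ⟨fun h => ?_, ?_⟩, fun ⟨x, y, z⟩ => ⟨fun h => ?_, ?_⟩,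
    fun x => ⟨(B₁ x, B₂ x, B₃ x), hB x⟩⟩
  · simp only [koszul₀, Prod.mk.injEq] at h
    rw [← hB x, ← hB y, ← h₁₁, ← h₂₂, ← h₃₃, ← h₁₁, ← h₂₂, ← h₃₃, h.1, h.2.1, h.2.2]
  · simp only [koszul₁, Prod.mk_eq_zero, sub_eq_zero] at h
    obtain ⟨e₁, e₂, e₃⟩ := h
    refine ⟨B₁ x + B₂ y + B₃ z, ?_⟩
    simp only [koszul₀, map_add, Prod.mk.injEq]
    refine ⟨?_, ?_, ?_⟩
    · conv_rhs => rw [← hB x]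
      rw [← h₂₁, ← h₃₁, e₃, ← e₂, h₂₂, h₃₃]
    · conv_rhs => rw [← hB y]
      rw [← h₁₂, ← h₃₂, ← e₃, e₁, h₁₁, h₃₃]
    · conv_rhs => rw [← hB z]
      rw [← h₁₃, ← h₂₃, e₂, ← e₁, h₁₁, h₂₂]
  · rintro ⟨w, hw⟩
    simp only [koszul₀, Prod.mk.injEq] at hw
    obtain ⟨rfl, rfl, rfl⟩ := hw
    simp [koszul₁, c₁₂, c₁₃, c₂₃]
  · simp only [koszul₂] at h
    refine ⟨(B₃ y - B₂ z, B₁ z - B₃ x, B₂ x - B₁ y), ?_⟩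
    have e₁ : T₁ x = -(T₂ y) - T₃ z := by rw [eq_sub_iff_add_eq, eq_neg_iff_add_eq_zero, ← h]; abel
    have e₂ : T₂ y = -(T₁ x) - T₃ z := by rw [eq_sub_iff_add_eq, eq_neg_iff_add_eq_zero, ← h]; abel
    have e₃ : T₃ z = -(T₁ x) - T₂ y := by rw [eq_sub_iff_add_eq, eq_neg_iff_add_eq_zero, ← h]; abel
    simp only [koszul₁, map_sub, Prod.mk.injEq]
    refine ⟨?_, ?_, ?_⟩
    · conv_rhs => rw [← hB x]
      rw [← h₁₁, e₁, map_sub, map_neg, h₁₂, h₁₃]; abel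
    · conv_rhs => rw [← hB y]
      rw [← h₂₂, e₂, map_sub, map_neg, h₂₁, h₂₃]; abel
    · conv_rhs => rw [← hB z]
      rw [← h₃₃, e₃, map_sub, map_neg, h₃₁, h₃₂]; abel
  · rintro ⟨⟨x', y', z'⟩, hw⟩
    simp only [koszul₁, Prod.mk.injEq] at hw
    obtain ⟨rfl, rfl, rfl⟩ := hw
    simp [koszul₂, c₁₂, c₁₃, c₂₃]

variable [CompleteSpace H]

/-- A column of three operators that is bounded below has an invertible Gram operator. -/
theorem isUnit_sum_adjoint_mul_self {D₁ D₂ D₃ : H →L[ℂ] H} {C : ℝ}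
    (h : ∀ x, ‖x‖ ≤ C * (‖D₁ x‖ + ‖D₂ x‖ + ‖D₃ x‖)) :
    IsUnit (D₁† * D₁ + D₂† * D₂ + D₃† * D₃) := by
  have hc : 0 < 3 * C ^ 2 + 1 := by positivity
  refine ContinuousLinearMap.isUnit_of_forall_le_norm_inner_map (𝕜 := ℂ) _
    (c := ⟨(3 * C ^ 2 + 1)⁻¹, by positivity⟩) (inv_pos.2 hc) fun x => ?_
  have e : ⟪(D₁† * D₁ + D₂† * D₂ + D₃† * D₃) x, x⟫_ℂ =
      ((‖D₁ x‖ ^ 2 + ‖D₂ x‖ ^ 2 + ‖D₃ x‖ ^ 2 : ℝ) : ℂ) := by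
    simp [ContinuousLinearMap.adjoint_inner_left, inner_self_eq_norm_sq_to_K]
  rw [e, Complex.norm_real, Real.norm_of_nonneg (by positivity)]
  change ‖x‖ ^ 2 * (3 * C ^ 2 + 1)⁻¹ ≤ _
  rw [← div_eq_mul_inv, div_le_iff₀ hc]
  have h1 : ‖x‖ ^ 2 ≤ C ^ 2 * (‖D₁ x‖ + ‖D₂ x‖ + ‖D₃ x‖) ^ 2 := by
    rw [← mul_pow]; exact pow_le_pow_left₀ (norm_nonneg _) (h x) 2
  have h2 : (‖D₁ x‖ + ‖D₂ x‖ + ‖D₃ x‖) ^ 2 ≤ 3 * (‖D₁ x‖ ^ 2 + ‖D₂ x‖ ^ 2 + ‖D₃ x‖ ^ 2) := by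
    nlinarith [sq_nonneg (‖D₁ x‖ - ‖D₂ x‖), sq_nonneg (‖D₁ x‖ - ‖D₃ x‖),
      sq_nonneg (‖D₂ x‖ - ‖D₃ x‖)]
  nlinarith [mul_le_mul_of_nonneg_left h2 (sq_nonneg C), sq_nonneg ‖D₁ x‖, sq_nonneg ‖D₂ x‖,
    sq_nonneg ‖D₃ x‖]

/-- If the last Koszul map is onto, then the row `(D₁, D₂, D₃)` is right invertible. -/
theorem isUnit_sum_mul_adjoint_self {D₁ D₂ D₃ : H →L[ℂ] H}
    (h : Function.Surjective (koszul₂ D₁ D₂ D₃)) :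
    IsUnit (D₁ * D₁† + D₂ * D₂† + D₃ * D₃†) := by
  let R : H × H × H →L[ℂ] H := D₁.coprod (D₂.coprod D₃)
  have hR (x : H × H × H) : R x = D₁ x.1 + D₂ x.2.1 + D₃ x.2.2 := by
    simp [R, ContinuousLinearMap.coprod_apply, add_assoc]
  have hs : Function.Surjective R := fun y => by
    obtain ⟨x, hx⟩ := h y
    exact ⟨x, by rw [hR]; exact hx⟩
  obtain ⟨C, hC, hpre⟩ := R.exists_preimage_norm_le hs
  have key : IsUnit ((D₁†)† * D₁† + (D₂†)† * D₂† + (D₃†)† * D₃†) := by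
    refine isUnit_sum_adjoint_mul_self (C := C) fun y => ?_
    obtain ⟨x, hx, hxn⟩ := hpre y
    rcases eq_or_ne y 0 with rfl | hy
    · simp
    have h1 : ‖x.1‖ ≤ C * ‖y‖ := (norm_fst_le x).trans hxn
    have h2 : ‖x.2.1‖ ≤ C * ‖y‖ := ((norm_fst_le x.2).trans (norm_snd_le x)).trans hxn
    have h3 : ‖x.2.2‖ ≤ C * ‖y‖ := ((norm_snd_le x.2).trans (norm_snd_le x)).trans hxn
    have e : ‖y‖ ^ 2 = ‖⟪x.1, (D₁†) y⟫_ℂ + ⟪x.2.1, (D₂†) y⟫_ℂ + ⟪x.2.2, (D₃†) y⟫_ℂ‖ := by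
      simp only [ContinuousLinearMap.adjoint_inner_right, ← inner_add_left]
      rw [← hR, hx, inner_self_eq_norm_sq_to_K]
      simp
    have hy' := norm_pos_iff.2 hy
    refine le_of_mul_le_mul_right ?_ hy'
    calc ‖y‖ * ‖y‖ = ‖⟪x.1, (D₁†) y⟫_ℂ + ⟪x.2.1, (D₂†) y⟫_ℂ + ⟪x.2.2, (D₃†) y⟫_ℂ‖ := by
          rw [← e, sq]
      _ ≤ ‖x.1‖ * ‖(D₁†) y‖ + ‖x.2.1‖ * ‖(D₂†) y‖ + ‖x.2.2‖ * ‖(D₃†) y‖ :=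
        norm_add₃_le.trans (by gcongr <;> exact norm_inner_le_norm _ _)
      _ ≤ (C * ‖y‖) * ‖(D₁†) y‖ + (C * ‖y‖) * ‖(D₂†) y‖ + (C * ‖y‖) * ‖(D₃†) y‖ := by gcongr
      _ = _ := by ring
  simpa using key

/-- In a commutative C*-algebra the relations of the distinguished boundary hold as soon as all
characters satisfy them, by the Gelfand theorem. A character kills `∑ (aᵢ - lᵢ)(aᵢ - lᵢ)*` for
`lᵢ = χ aᵢ`, so this sum is not invertible at such a point. -/
theorem relations_of_isUnit {A : Type*} [CommCStarAlgebra A] {a₁ a₂ a₃ : A}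
    (h : ∀ l : ℂ × ℂ × ℂ, l ∉ distinguishedBoundary →
      IsUnit ((a₁ - l.1 • 1) * star (a₁ - l.1 • 1) + (a₂ - l.2.1 • 1) * star (a₂ - l.2.1 • 1) +
        (a₃ - l.2.2 • 1) * star (a₃ - l.2.2 • 1))) :
    a₁ = star a₂ * a₃ ∧ star a₃ * a₃ = 1 ∧ ‖a₂‖ ≤ 1 := by
  have key (χ : WeakDual.characterSpace ℂ A) : (χ a₁, χ a₂, χ a₃) ∈ distinguishedBoundary := by
    by_contra hχ
    have := (h _ hχ).map χ
    simp only [map_add, map_mul, map_sub, map_smul, map_one, smul_eq_mul, mul_one, sub_self,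
      zero_mul, add_zero, isUnit_zero_iff, zero_ne_one] at this
  refine ⟨(gelfandTransform_isometry A).injective (ContinuousMap.ext fun χ => ?_),
    (gelfandTransform_isometry A).injective (ContinuousMap.ext fun χ => ?_), ?_⟩
  · change χ a₁ = χ (star a₂ * a₃)
    rw [map_mul, map_star]
    exact (key χ).1
  · change χ (star a₃ * a₃) = χ 1
    rw [map_mul, map_star, map_one]
    have h3 : ‖χ a₃‖ = 1 := (key χ).2.2
    rw [RCLike.star_def, Complex.conj_mul', h3]
    simp
  · rw [← (AddMonoidHomClass.isometry_iff_norm _).1 (gelfandTransform_isometry A) a₂]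
    exact (ContinuousMap.norm_le _ zero_le_one).2 fun χ => (key χ).2.1

open scoped IsMulCommutative in
/-- The operators of an `𝔼`-unitary satisfy the equations and inequalities that define the
distinguished boundary. By Fuglede's theorem the triple generates a commutative C*-algebra, and at
a point outside the Taylor spectrum the sum `∑ (Nᵢ - lᵢ)(Nᵢ - lᵢ)*` is invertible, also within that
algebra. -/
theorem IsEUnitary.relations {N₁ N₂ N₃ : H →L[ℂ] H} (h : IsEUnitary N₁ N₂ N₃) :
    N₁ = N₂† * N₃ ∧ N₃† * N₃ = 1 ∧ ‖N₂‖ ≤ 1 := by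
  have n₁ := h.normal₁
  have n₂ := h.normal₂
  have n₃ := h.normal₃
  have c₁₂ : Commute N₁ N₂ := h.commuting.comm₁₂
  have c₁₃ : Commute N₁ N₃ := h.commuting.comm₁₃
  have c₂₃ : Commute N₂ N₃ := h.commuting.comm₂₃
  let s : Set (H →L[ℂ] H) := {N₁, N₂, N₃}
  have hs : ∀ a ∈ s, IsStarNormal a := by
    simp only [s, Set.mem_insert_iff, Set.mem_singleton_iff]
    rintro a (rfl | rfl | rfl) <;> assumption
  have hc : ∀ a ∈ s, ∀ b ∈ s, Commute a b := by
    simp only [s, Set.mem_insert_iff, Set.mem_singleton_iff]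
    rintro a (rfl | rfl | rfl) b (rfl | rfl | rfl) <;>
      first | exact Commute.refl _ | assumption | (apply Commute.symm; assumption)
  have : IsMulCommutative (StarAlgebra.adjoin ℂ s) :=
    StarAlgebra.isMulCommutative_adjoin ℂ (fun a ha b hb => hc a ha b hb)
      fun a ha b hb => (hs b hb).commute_star_right (hc a ha b hb)
  let S : StarSubalgebra ℂ (H →L[ℂ] H) := (StarAlgebra.adjoin ℂ s).topologicalClosure
  have hS : IsClosed (S : Set (H →L[ℂ] H)) :=
    (StarAlgebra.adjoin ℂ s).isClosed_topologicalClosure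
  let _ : CommRing S := (StarAlgebra.adjoin ℂ s).commRingTopologicalClosure mul_comm
  let _ : CommCStarAlgebra S := { }
  have hmem : ∀ a ∈ s, a ∈ S := fun a ha =>
    StarSubalgebra.le_topologicalClosure _ (StarAlgebra.subset_adjoin ℂ s ha)
  obtain ⟨e₁, e₃, e₂⟩ := relations_of_isUnit (A := S) (a₁ := ⟨N₁, hmem _ (by simp [s])⟩)
    (a₂ := ⟨N₂, hmem _ (by simp [s])⟩) (a₃ := ⟨N₃, hmem _ (by simp [s])⟩) fun l hl => by
      rw [← StarSubalgebra.coe_isUnit]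
      exact isUnit_sum_mul_adjoint_self (not_not.1 fun hreg => hl (h.spectrum_subset hreg)).2.2.2
  exact ⟨congrArg Subtype.val e₁, congrArg Subtype.val e₃, e₂⟩

/-- The converse: the relations make `N₁*` and `N₂*` multiples of `N₂` and `N₁` by `N₃*`, so that
normality and all commutation relations with adjoints come for free. -/
theorem isEUnitary_of_relations {N₁ N₂ N₃ : H →L[ℂ] H} (hc : CommutingTriple N₁ N₂ N₃)
    (h₁ : N₁ = N₂† * N₃) (h₃ : N₃† * N₃ = 1) (h₃' : N₃ * N₃† = 1) (h₂ : ‖N₂‖ ≤ 1) :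
    IsEUnitary N₁ N₂ N₃ := by
  have c₁₂ : Commute N₁ N₂ := hc.comm₁₂
  have c₁₃ : Commute N₁ N₃ := hc.comm₁₃
  have c₂₃ : Commute N₂ N₃ := hc.comm₂₃
  -- the adjoint of `N₃` is its inverse, hence commutes with everything that `N₃` commutes with
  have inv {X : H →L[ℂ] H} (hX : Commute X N₃) : Commute X (N₃†) := by
    calc X * N₃† = N₃† * N₃ * (X * N₃†) := by rw [h₃, one_mul]
      _ = N₃† * (N₃ * X) * N₃† := by simp only [mul_assoc]
      _ = N₃† * X * (N₃ * N₃†) := by rw [← hX.eq]; simp only [mul_assoc]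
      _ = N₃† * X := by rw [h₃', mul_one]
  have a₂ : N₂† = N₁ * N₃† := by rw [h₁, mul_assoc, h₃', mul_one]
  have a₁ : N₁† = N₃† * N₂ := by
    rw [h₁]
    change star (star N₂ * N₃) = star N₃ * N₂
    rw [star_mul, star_star]
  have s₃₃ : Commute N₃ (N₃†) := inv (Commute.refl _)
  have s₁₃ : Commute N₁ (N₃†) := inv c₁₃
  have s₂₃ : Commute N₂ (N₃†) := inv c₂₃
  have s₁₂ : Commute N₁ (N₂†) := by rw [a₂]; exact (Commute.refl _).mul_right s₁₃
  have s₂₂ : Commute N₂ (N₂†) := by rw [a₂]; exact c₁₂.symm.mul_right s₂₃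
  have s₃₂ : Commute N₃ (N₂†) := by rw [a₂]; exact c₁₃.symm.mul_right s₃₃
  have s₁₁ : Commute N₁ (N₁†) := by rw [a₁]; exact s₁₃.mul_right c₁₂
  have s₂₁ : Commute N₂ (N₁†) := by rw [a₁]; exact s₂₃.mul_right (Commute.refl _)
  have s₃₁ : Commute N₃ (N₁†) := by rw [a₁]; exact s₃₃.mul_right c₂₃.symm
  refine ⟨hc, ⟨s₁₁.symm⟩, ⟨s₂₂.symm⟩, ⟨s₃₃.symm⟩, ?_⟩
  rintro ⟨l₁, l₂, l₃⟩ hl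
  by_contra hb
  refine hl ?_
  simp only
  set D₁ := N₁ - l₁ • ContinuousLinearMap.id ℂ H with hD₁
  set D₂ := N₂ - l₂ • ContinuousLinearMap.id ℂ H with hD₂
  set D₃ := N₃ - l₃ • ContinuousLinearMap.id ℂ H with hD₃
  have star_sub_smul (N : H →L[ℂ] H) (l : ℂ) :
      (N - l • ContinuousLinearMap.id ℂ H)† = N† - conj l • ContinuousLinearMap.id ℂ H := by
    change star (N - l • (1 : H →L[ℂ] H)) = star N - conj l • (1 : H →L[ℂ] H)
    simp
  have comm_sub {X Y : H →L[ℂ] H} (l m : ℂ) (hXY : Commute X Y) :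
      Commute (X - l • ContinuousLinearMap.id ℂ H) (Y - m • ContinuousLinearMap.id ℂ H) :=
    Commute.sub_left (hXY.sub_right ((Commute.one_right X).smul_right m))
      ((Commute.one_left _).smul_left l)
  have d₁₂ : Commute D₁ D₂ := comm_sub _ _ c₁₂
  have d₁₃ : Commute D₁ D₃ := comm_sub _ _ c₁₃
  have d₂₃ : Commute D₂ D₃ := comm_sub _ _ c₂₃
  have e₁₁ : Commute D₁ (D₁†) := by rw [star_sub_smul]; exact comm_sub _ _ s₁₁
  have e₁₂ : Commute D₁ (D₂†) := by rw [star_sub_smul]; exact comm_sub _ _ s₁₂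
  have e₁₃ : Commute D₁ (D₃†) := by rw [star_sub_smul]; exact comm_sub _ _ s₁₃
  have e₂₁ : Commute D₂ (D₁†) := by rw [star_sub_smul]; exact comm_sub _ _ s₂₁
  have e₂₂ : Commute D₂ (D₂†) := by rw [star_sub_smul]; exact comm_sub _ _ s₂₂
  have e₂₃ : Commute D₂ (D₃†) := by rw [star_sub_smul]; exact comm_sub _ _ s₂₃
  have e₃₁ : Commute D₃ (D₁†) := by rw [star_sub_smul]; exact comm_sub _ _ s₃₁
  have e₃₂ : Commute D₃ (D₂†) := by rw [star_sub_smul]; exact comm_sub _ _ s₃₂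
  have e₃₃ : Commute D₃ (D₃†) := by rw [star_sub_smul]; exact comm_sub _ _ s₃₃
  -- it suffices to bound the column `(D₁, D₂, D₃)` from below
  suffices hbd : ∃ C : ℝ, ∀ x, ‖x‖ ≤ C * (‖D₁ x‖ + ‖D₂ x‖ + ‖D₃ x‖) by
    obtain ⟨C, hC⟩ := hbd
    obtain ⟨u, hu⟩ := isUnit_sum_adjoint_mul_self hC
    have q₁ : Commute D₁ (↑u⁻¹ : H →L[ℂ] H) := by
      refine Commute.units_inv_right ?_
      rw [hu]
      exact ((e₁₁.mul_right (.refl _)).add_right (e₁₂.mul_right d₁₂)).add_right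
        (e₁₃.mul_right d₁₃)
    have q₂ : Commute D₂ (↑u⁻¹ : H →L[ℂ] H) := by
      refine Commute.units_inv_right ?_
      rw [hu]
      exact ((e₂₁.mul_right d₁₂.symm).add_right (e₂₂.mul_right (.refl _))).add_right
        (e₂₃.mul_right d₂₃)
    have q₃ : Commute D₃ (↑u⁻¹ : H →L[ℂ] H) := by
      refine Commute.units_inv_right ?_
      rw [hu]
      exact ((e₃₁.mul_right d₁₃.symm).add_right (e₃₂.mul_right d₂₃.symm)).add_right
        (e₃₃.mul_right (.refl _))
    refine TaylorRegular.of_left_inverse (B₁ := (↑u⁻¹ : H →L[ℂ] H) * D₁†)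
      (B₂ := (↑u⁻¹ : H →L[ℂ] H) * D₂†) (B₃ := (↑u⁻¹ : H →L[ℂ] H) * D₃†)
      ⟨d₁₂, d₁₃, d₂₃⟩ (q₁.mul_right e₁₁).symm (q₂.mul_right e₂₁).symm
      (q₃.mul_right e₃₁).symm (q₁.mul_right e₁₂).symm (q₂.mul_right e₂₂).symm
      (q₃.mul_right e₃₂).symm (q₁.mul_right e₁₃).symm (q₂.mul_right e₂₃).symm
      (q₃.mul_right e₃₃).symm ?_
    simp only [mul_assoc, ← mul_add]
    rw [← hu, Units.inv_mul]
  have N₃x (x : H) : ‖N₃ x‖ = ‖x‖ := by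
    have := ContinuousLinearMap.norm_map_iff_adjoint_comp_self N₃ |>.2 h₃
    exact this x
  by_cases h3 : ‖l₃‖ = 1
  · by_cases h2 : ‖l₂‖ ≤ 1
    · -- the point violates the equation `l₁ = conj l₂ * l₃`
      set c := conj l₂ * l₃ - l₁ with hcdef
      have hc0 : c ≠ 0 := fun h0 => hb ⟨(sub_eq_zero.1 h0).symm, h2, h3⟩
      have D₂x (x : H) : ‖(D₂†) x‖ = ‖D₂ x‖ := by
        have : IsStarNormal D₂ := ⟨e₂₂.symm⟩
        exact (ContinuousLinearMap.isStarNormal_iff_norm_eq_adjoint.1 this x).symm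
      have id (x : H) : c • x = D₁ x - N₃ ((D₂†) x) - conj l₂ • D₃ x := by
        have hx : N₁ x = N₃ ((N₂†) x) := by
          conv_lhs => rw [h₁]
          exact (DFunLike.congr_fun s₃₂.eq x).symm
        simp only [hD₂, star_sub_smul]
        simp only [hD₁, hD₃, hcdef, sub_apply, smul_apply, ContinuousLinearMap.id_apply, map_sub,
          map_smul, hx]
        module
      refine ⟨‖c‖⁻¹, fun x => ?_⟩
      rw [← div_eq_inv_mul, le_div_iff₀ (norm_pos_iff.2 hc0), mul_comm, ← norm_smul, id]
      calc ‖D₁ x - N₃ ((D₂†) x) - conj l₂ • D₃ x‖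
          ≤ ‖D₁ x‖ + ‖N₃ ((D₂†) x)‖ + ‖conj l₂ • D₃ x‖ :=
            (norm_sub_le _ _).trans (by gcongr; exact norm_sub_le _ _)
        _ ≤ ‖D₁ x‖ + ‖D₂ x‖ + ‖D₃ x‖ := by
            rw [N₃x, D₂x, norm_smul, RCLike.norm_conj]
            gcongr
            exact mul_le_of_le_one_left (norm_nonneg _) h2
    · refine ⟨(‖l₂‖ - 1)⁻¹, fun x => ?_⟩
      push Not at h2
      rw [← div_eq_inv_mul, le_div_iff₀ (sub_pos.2 h2)]
      have : l₂ • x = N₂ x - D₂ x := by simp [hD₂]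
      have h4 : ‖l₂‖ * ‖x‖ ≤ ‖x‖ + ‖D₂ x‖ := by
        rw [← norm_smul, this]
        exact (norm_sub_le _ _).trans (by
          gcongr
          exact (N₂.le_of_opNorm_le h₂ x).trans_eq (one_mul _))
      linarith [norm_nonneg (D₁ x), norm_nonneg (D₃ x)]
  · refine ⟨|‖l₃‖ - 1|⁻¹, fun x => ?_⟩
    rw [← div_eq_inv_mul, le_div_iff₀ (abs_pos.2 (sub_ne_zero.2 h3))]
    have h4 : |‖N₃ x‖ - ‖l₃ • x‖| ≤ ‖D₃ x‖ := by
      have : D₃ x = N₃ x - l₃ • x := by simp [hD₃]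
      rw [this]
      exact abs_norm_sub_norm_le _ _
    have h5 : ‖x‖ * |‖l₃‖ - 1| = |‖N₃ x‖ - ‖l₃ • x‖| := by
      rw [N₃x, norm_smul, abs_sub_comm, ← abs_of_nonneg (norm_nonneg x), ← abs_mul,
        abs_of_nonneg (norm_nonneg x)]
      ring_nf
    linarith [norm_nonneg (D₁ x), norm_nonneg (D₂ x)]

end Unitaries

/-! ### Multiplication operators and Fourier coefficients -/

section Multiplication

theorem integrable_coeFn {E : Type*} [NormedAddCommGroup E]
    (f : Lp E 2 (AddCircle.haarAddCircle (T := (1 : ℝ)))) :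
    Integrable (f : UnitAddCircle → E) AddCircle.haarAddCircle :=
  (Lp.memLp f).integrable one_le_two

variable {E : Type u} [NormedAddCommGroup E] [InnerProductSpace ℂ E]

/-- The embedding `x ↦ zⁿ x` of `E` in `L²(E)`. -/
noncomputable def monomial (E : Type u) [NormedAddCommGroup E] [InnerProductSpace ℂ E] (n : ℤ) :
    E →ₗ[ℂ] LTwo E where
  toFun x := ContinuousMap.toLp 2 AddCircle.haarAddCircle ℂ
    (⟨fun t => fourier n t • x, by fun_prop⟩ : C(UnitAddCircle, E))
  map_add' x y := by
    rw [← map_add]; congr 1; ext t; simp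
  map_smul' c x := by
    rw [← map_smul]; congr 1; ext t; exact smul_comm _ _ _

theorem coeFn_monomial (n : ℤ) (x : E) :
    monomial E n x =ᵐ[AddCircle.haarAddCircle] fun t => fourier n t • x :=
  ContinuousMap.coeFn_toLp (p := 2) (𝕜 := ℂ) (AddCircle.haarAddCircle (T := (1 : ℝ))) _

theorem monomial_zero (x : E) : monomial E 0 x = Lp.const 2 _ x := by
  refine Lp.ext ?_
  filter_upwards [coeFn_monomial 0 x, Lp.coeFn_const (p := 2)
    (μ := AddCircle.haarAddCircle (T := (1 : ℝ))) (c := x)] with t h1 h2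
  rw [h1, h2, fourier_zero, one_smul]
  rfl

variable [CompleteSpace E]

theorem coeFn_multOp (φ : C(UnitAddCircle, E →L[ℂ] E)) (f : LTwo E) :
    multOp φ f =ᵐ[AddCircle.haarAddCircle] fun t => φ t (f t) := by
  filter_upwards [(ContinuousLinearMap.id ℂ (E →L[ℂ] E)).coeFn_holder (r := 2)
    (ContinuousMap.toLp ∞ AddCircle.haarAddCircle ℂ φ) f,
    ContinuousMap.coeFn_toLp (p := ∞) (𝕜 := ℂ) (AddCircle.haarAddCircle (T := (1 : ℝ))) φ]
    with t h1 h2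
  rw [h2] at h1
  exact h1

theorem multOp_one : multOp (1 : C(UnitAddCircle, E →L[ℂ] E)) = 1 := by
  ext1 f
  refine Lp.ext ?_
  filter_upwards [coeFn_multOp 1 f] with t h1
  rw [h1]
  rfl

theorem multOp_mul (φ ψ : C(UnitAddCircle, E →L[ℂ] E)) :
    multOp (φ * ψ) = multOp φ * multOp ψ := by
  ext1 f
  refine Lp.ext ?_
  filter_upwards [coeFn_multOp (φ * ψ) f, coeFn_multOp φ (multOp ψ f), coeFn_multOp ψ f]
    with t h1 h2 h3
  rw [h1, mul_apply_eq_comp, h2, h3]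
  rfl

theorem norm_multOp_le {φ : C(UnitAddCircle, E →L[ℂ] E)} {c : ℝ} (hc : 0 ≤ c)
    (h : ∀ t, ‖φ t‖ ≤ c) : ‖multOp φ‖ ≤ c := by
  refine ContinuousLinearMap.opNorm_le_bound _ hc fun f => ?_
  refine Lp.norm_le_mul_norm_of_ae_le_mul ?_
  filter_upwards [coeFn_multOp φ f] with t ht
  rw [ht]
  exact (φ t).le_of_opNorm_le (h t) _

theorem multOp_star (φ : C(UnitAddCircle, E →L[ℂ] E)) : multOp (star φ) = (multOp φ)† := by
  rw [ContinuousLinearMap.eq_adjoint_iff]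
  intro f g
  rw [L2.inner_def, L2.inner_def]
  refine integral_congr_ae ?_
  filter_upwards [coeFn_multOp (star φ) f, coeFn_multOp φ g] with t h1 h2
  rw [h1, h2]
  exact ContinuousLinearMap.adjoint_inner_left _ _ _

/-- Multiplication by `B + z C` changes the `n`-th Fourier coefficient `f̂ n` of `f` into
`B (f̂ n) + C (f̂ (n - 1))`. -/
theorem fourierCoeff_multOp_affineSymbol (B C : E →L[ℂ] E) (f : LTwo E) (n : ℤ) :
    fourierCoeff (multOp (affineSymbol B C) f : UnitAddCircle → E) n =
      B (fourierCoeff (f : UnitAddCircle → E) n) +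
        C (fourierCoeff (f : UnitAddCircle → E) (n - 1)) := by
  have i (m : ℤ) := (integrable_coeFn f).fourier_smul (-m)
  rw [fourierCoeff, fourierCoeff, fourierCoeff, ← B.integral_comp_comm (i n),
    ← C.integral_comp_comm (i (n - 1)), ← integral_add (B.integrable_comp (i n))
      (C.integrable_comp (i (n - 1)))]
  refine integral_congr_ae ?_
  filter_upwards [coeFn_multOp (affineSymbol B C) f] with t ht
  have e : -(n - 1) = -n + 1 := by ring
  rw [ht, e, fourier_add]
  simp only [affineSymbol, ContinuousMap.coe_mk, add_apply, smul_apply, smul_add, map_smul,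
    mul_smul]

theorem multOp_affineSymbol_monomial (B C : E →L[ℂ] E) (n : ℤ) (x : E) :
    multOp (affineSymbol B C) (monomial E n x) = monomial E n (B x) + monomial E (n + 1) (C x) := by
  refine Lp.ext ?_
  filter_upwards [coeFn_multOp (affineSymbol B C) (monomial E n x), coeFn_monomial n x,
    coeFn_monomial n (B x), coeFn_monomial (n + 1) (C x),
    Lp.coeFn_add (monomial E n (B x)) (monomial E (n + 1) (C x))] with t h1 h2 h3 h4 h5
  rw [h1, h5, Pi.add_apply, h2, h3, h4, fourier_add]
  simp only [affineSymbol, ContinuousMap.coe_mk, add_apply, smul_apply, map_smul, mul_smul,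
    smul_add]

theorem inner_monomial (n : ℤ) (x : E) (f : LTwo E) :
    ⟪monomial E n x, f⟫_ℂ = ⟪x, fourierCoeff (f : UnitAddCircle → E) n⟫_ℂ := by
  rw [L2.inner_def, fourierCoeff, ← integral_inner ((integrable_coeFn f).fourier_smul (-n))]
  refine integral_congr_ae ?_
  filter_upwards [coeFn_monomial n x] with t ht
  rw [ht, inner_smul_left, inner_smul_right, fourier_neg]

theorem fourierCoeff_monomial (m n : ℤ) (x : E) :
    fourierCoeff (monomial E m x : UnitAddCircle → E) n = if n = m then x else 0 := by
  have h : fourierCoeff (monomial E m x : UnitAddCircle → E) n =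
      fourierCoeff (fourier m : UnitAddCircle → ℂ) n • x := by
    rw [fourierCoeff, fourierCoeff, ← integral_smul_const]
    refine integral_congr_ae ?_
    filter_upwards [coeFn_monomial m x] with t ht
    rw [ht, smul_assoc]
  rw [h, fourierCoeff_fourier, Pi.single_apply]
  split_ifs <;> simp

/-- A function in `L²(E)` is determined by its Fourier coefficients. This reduces to scalar
functions by pairing with the functionals on `E`. -/
theorem eq_zero_of_fourierCoeff_eq_zero {f : LTwo E}
    (h : ∀ n, fourierCoeff (f : UnitAddCircle → E) n = 0) : f = 0 := by
  obtain ⟨s, hs, hfs⟩ := (Lp.aestronglyMeasurable f).isSeparable_ae_range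
  refine Lp.ext ((ae_eq_zero_of_forall_dual_of_isSeparable ℂ hs (fun c => ?_) hfs).trans
    (Lp.coeFn_zero E 2 _).symm)
  have hg : MemLp (fun t => c (f t)) 2 (AddCircle.haarAddCircle (T := (1 : ℝ))) :=
    c.comp_memLp' (Lp.memLp f)
  have h0 : hg.toLp = 0 := by
    rw [← (fourierBasis (T := (1 : ℝ))).repr.map_eq_zero_iff]
    ext n
    rw [fourierBasis_repr, fourierCoeff_congr_ae hg.coeFn_toLp]
    have e : fourierCoeff (fun t => c (f t)) n = c (fourierCoeff (f : UnitAddCircle → E) n) := by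
      rw [fourierCoeff, fourierCoeff,
        ← c.integral_comp_comm ((integrable_coeFn f).fourier_smul (-n))]
      simp only [map_smul]
    rw [e, h, map_zero]
    rfl
  filter_upwards [hg.coeFn_toLp, Lp.coeFn_zero ℂ 2 (AddCircle.haarAddCircle (T := (1 : ℝ)))]
    with t h1 h2
  rw [← h1, h0, h2]

end Multiplication

/-! ### The Hardy space as a Hilbert sum, and the shift -/

section Hardy

variable {E : Type u} [NormedAddCommGroup E] [InnerProductSpace ℂ E] [CompleteSpace E]

theorem multOp_affineSymbol_mem_hardySpace (B C : E →L[ℂ] E) {f : LTwo E} (hf : f ∈ hardySpace E) :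
    multOp (affineSymbol B C) f ∈ hardySpace E := fun n hn => by
  rw [fourierCoeff_multOp_affineSymbol, hf n hn, hf (n - 1) (by lia), map_zero, map_zero, add_zero]

/-- The symbol `B + z C` is analytic, so that no projection is needed in its Toeplitz operator. -/
theorem coe_toeplitz_affineSymbol (B C : E →L[ℂ] E) (f : hardySpace E) :
    (toeplitz (affineSymbol B C) f : LTwo E) = multOp (affineSymbol B C) f := by
  have := Submodule.orthogonalProjectionOnto_mem_subspace_eq_self (K := hardySpace E)
    ⟨_, multOp_affineSymbol_mem_hardySpace B C f.2⟩
  exact congrArg Subtype.val this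

theorem monomial_mem_hardySpace (n : ℕ) (x : E) : monomial E n x ∈ hardySpace E := fun m hm => by
  rw [fourierCoeff_monomial, if_neg (by lia)]

/-- The isometric embedding `x ↦ zⁿ x` of `E` in `H²(E)`, for `n ≥ 0`. -/
noncomputable def hardyMonomial (E : Type u) [NormedAddCommGroup E] [InnerProductSpace ℂ E]
    [CompleteSpace E] (n : ℕ) : E →ₗᵢ[ℂ] hardySpace E :=
  ((monomial E n).codRestrict (hardySpace E) (monomial_mem_hardySpace n)).isometryOfInner
    fun x y => by
      change ⟪monomial E n x, monomial E n y⟫_ℂ = _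
      rw [inner_monomial, fourierCoeff_monomial, if_pos rfl]

@[simp]
theorem coe_hardyMonomial (n : ℕ) (x : E) :
    (hardyMonomial E n x : LTwo E) = monomial E n x := rfl

theorem inner_hardyMonomial (n : ℕ) (x : E) (f : hardySpace E) :
    ⟪hardyMonomial E n x, f⟫_ℂ = ⟪x, fourierCoeff ((f : LTwo E) : UnitAddCircle → E) n⟫_ℂ := by
  rw [Submodule.coe_inner, coe_hardyMonomial, inner_monomial]

theorem orthogonalFamily_hardyMonomial :
    OrthogonalFamily ℂ (fun _ : ℕ => E) (hardyMonomial E) := fun i j hij x y => by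
  rw [inner_hardyMonomial, coe_hardyMonomial, fourierCoeff_monomial,
    if_neg (by exact_mod_cast hij), inner_zero_right]

theorem dense_iSup_range_hardyMonomial :
    ⊤ ≤ (⨆ n, LinearMap.range (hardyMonomial E n).toLinearMap).topologicalClosure := by
  rw [top_le_iff, Submodule.topologicalClosure_eq_top_iff, Submodule.eq_bot_iff]
  intro f hf
  refine Subtype.ext (eq_zero_of_fourierCoeff_eq_zero fun n => ?_)
  rcases lt_or_ge n 0 with hn | hn
  · exact f.2 n hn
  · lift n to ℕ using hn
    refine ext_inner_left ℂ fun x => ?_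
    rw [inner_zero_right, ← inner_hardyMonomial]
    exact hf _ (Submodule.mem_iSup_of_mem n ⟨x, rfl⟩)

theorem isHilbertSum_hardyMonomial :
    IsHilbertSum ℂ (fun _ : ℕ => E) (hardyMonomial E) :=
  .mk orthogonalFamily_hardyMonomial dense_iSup_range_hardyMonomial

theorem toeplitz_affineSymbol_hardyMonomial (B C : E →L[ℂ] E) (n : ℕ) (x : E) :
    toeplitz (affineSymbol B C) (hardyMonomial E n x) =
      hardyMonomial E n (B x) + hardyMonomial E (n + 1) (C x) := by
  refine Subtype.ext ?_
  rw [coe_toeplitz_affineSymbol, coe_hardyMonomial, multOp_affineSymbol_monomial]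
  rfl

theorem inner_hardyMonomial_toeplitzZ (n : ℕ) (x : E) (f : hardySpace E) :
    ⟪hardyMonomial E n x, toeplitzZ f⟫_ℂ =
      ⟪x, fourierCoeff ((f : LTwo E) : UnitAddCircle → E) (n - 1)⟫_ℂ := by
  rw [inner_hardyMonomial, toeplitzZ, coe_toeplitz_affineSymbol, fourierCoeff_multOp_affineSymbol]
  simp

/-- The adjoint of the shift lowers the exponent of a monomial, and kills the constants. -/
theorem adjoint_toeplitzZ_pow_hardyMonomial {k n : ℕ} (h : k < n) (x : E) :
    ((toeplitzZ (E := E)†) ^ n) (hardyMonomial E k x) = 0 := by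
  induction n generalizing k with
  | zero => exact absurd h (Nat.not_lt_zero _)
  | succ n ih =>
    rw [pow_succ, mul_apply_eq_comp]
    cases k with
    | zero =>
      have : (toeplitzZ (E := E)†) (hardyMonomial E 0 x) = 0 := by
        refine ext_inner_right ℂ fun f => ?_
        rw [ContinuousLinearMap.adjoint_inner_left, inner_hardyMonomial_toeplitzZ, inner_zero_left,
          f.2 _ (by simp), inner_zero_right]
      rw [this, map_zero]
    | succ k =>
      have : (toeplitzZ (E := E)†) (hardyMonomial E (k + 1) x) = hardyMonomial E k x := by
        refine ext_inner_right ℂ fun f => ?_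
        rw [ContinuousLinearMap.adjoint_inner_left, inner_hardyMonomial_toeplitzZ,
          inner_hardyMonomial]
        simp
      rw [this, ih (by lia)]

/-- Strong convergence to `0` of the powers of a contraction may be tested on a dense subspace. -/
theorem tendsto_pow_apply_zero_of_dense {H : Type*} [NormedAddCommGroup H] [InnerProductSpace ℂ H]
    {A : H →L[ℂ] H} (hA : ‖A‖ ≤ 1) {S : Submodule ℂ H} (hS : ⊤ ≤ S.topologicalClosure)
    (h : ∀ x ∈ S, Tendsto (fun n : ℕ => (A ^ n) x) atTop (𝓝 0)) (x : H) :
    Tendsto (fun n : ℕ => (A ^ n) x) atTop (𝓝 0) := by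
  have hAn (n : ℕ) (y : H) : ‖(A ^ n) y‖ ≤ ‖y‖ := by
    induction n with
    | zero => simp
    | succ n ih =>
      rw [pow_succ', mul_apply_eq_comp]
      exact ((A.le_of_opNorm_le hA _).trans_eq (one_mul _)).trans ih
  rw [Metric.tendsto_atTop]
  intro ε hε
  have hx : x ∈ closure (S : Set H) := hS (Submodule.mem_top (x := x))
  obtain ⟨y, hy, hxy⟩ := Metric.mem_closure_iff.1 hx (ε / 2) (half_pos hε)
  obtain ⟨N, hN⟩ := Metric.tendsto_atTop.1 (h y hy) (ε / 2) (half_pos hε)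
  refine ⟨N, fun n hn => ?_⟩
  have h1 := hN n hn
  have h2 := hAn n (x - y)
  rw [dist_zero_right] at h1 ⊢
  rw [dist_eq_norm] at hxy
  rw [map_sub] at h2
  linarith [norm_le_insert' ((A ^ n) x) ((A ^ n) y)]

theorem affineSymbol_zero_one_apply (t : UnitAddCircle) :
    affineSymbol (0 : E →L[ℂ] E) 1 t = fourier 1 t • 1 := by
  simp only [affineSymbol, ContinuousMap.coe_mk, zero_add]

theorem conj_fourier_mul_fourier (n : ℤ) (t : UnitAddCircle) :
    conj (fourier n t) * fourier n t = 1 := by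
  rw [← fourier_neg, ← fourier_add, neg_add_cancel, fourier_zero]

theorem star_affineSymbol_mul_self :
    star (affineSymbol (0 : E →L[ℂ] E) 1) * affineSymbol 0 1 = 1 := by
  ext1 t
  rw [ContinuousMap.mul_apply, ContinuousMap.star_apply, affineSymbol_zero_one_apply, star_smul,
    smul_mul_smul_comm, star_one, one_mul, RCLike.star_def, conj_fourier_mul_fourier, one_smul]
  rfl

theorem affineSymbol_mul_star_self :
    affineSymbol (0 : E →L[ℂ] E) 1 * star (affineSymbol (0 : E →L[ℂ] E) 1) = 1 := by
  ext1 t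
  rw [ContinuousMap.mul_apply, ContinuousMap.star_apply, affineSymbol_zero_one_apply, star_smul,
    smul_mul_smul_comm, star_one, one_mul, RCLike.star_def, mul_comm, conj_fourier_mul_fourier,
    one_smul]
  rfl

theorem isPureIsometry_toeplitzZ : IsPureIsometry (toeplitzZ (E := E)) := by
  have hiso : ∀ f, ‖toeplitzZ (E := E) f‖ = ‖f‖ := fun f => by
    have h := (ContinuousLinearMap.norm_map_iff_adjoint_comp_self
      (multOp (affineSymbol (0 : E →L[ℂ] E) 1))).2 (by
        rw [← multOp_star]
        exact (multOp_mul _ _).symm.trans (by rw [star_affineSymbol_mul_self, multOp_one])) f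
    rw [← Submodule.norm_coe, toeplitzZ, coe_toeplitz_affineSymbol]
    exact h
  refine ⟨AddMonoidHomClass.isometry_of_norm _ hiso, ?_⟩
  have hn : ‖toeplitzZ (E := E)†‖ ≤ 1 := by
    rw [LinearIsometryEquiv.norm_map]
    exact ContinuousLinearMap.opNorm_le_bound _ zero_le_one fun f => by rw [hiso, one_mul]
  refine tendsto_pow_apply_zero_of_dense hn
    (S := ⨆ n, LinearMap.range (hardyMonomial E n).toLinearMap) dense_iSup_range_hardyMonomial
    fun f hf => ?_
  induction hf using Submodule.iSup_induction' with
  | mem n f hf =>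
    obtain ⟨x, rfl⟩ := hf
    refine tendsto_const_nhds.congr' ?_
    filter_upwards [eventually_gt_atTop n] with m hm
    exact (adjoint_toeplitzZ_pow_hardyMonomial hm x).symm
  | zero => simp
  | add f g _ _ hf hg => simpa using hf.add hg

end Hardy

/-! ### The model triple is a pure `𝔼`-isometry -/

section Model

variable {E : Type u} [NormedAddCommGroup E] [InnerProductSpace ℂ E] [CompleteSpace E]

theorem affineSymbol_apply (B C : E →L[ℂ] E) (t : UnitAddCircle) :
    affineSymbol B C t = B + (fourier 1 t : ℂ) • C := rfl

/-- On the circle, `A₁* + z A₂ = (A₂* + z A₁)* z`. -/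
theorem affineSymbol_eq_star_mul (A₁ A₂ : E →L[ℂ] E) :
    affineSymbol (A₁†) A₂ = star (affineSymbol (A₂†) A₁) * affineSymbol 0 1 := by
  ext1 t
  rw [ContinuousMap.mul_apply, ContinuousMap.star_apply, affineSymbol_zero_one_apply,
    affineSymbol_apply, affineSymbol_apply, star_add, star_smul, mul_smul_comm, mul_one, smul_add,
    smul_smul, RCLike.star_def, mul_comm, conj_fourier_mul_fourier, one_smul,
    ContinuousLinearMap.star_eq_adjoint, ContinuousLinearMap.star_eq_adjoint,
    ContinuousLinearMap.adjoint_adjoint, add_comm]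

theorem commute_affineSymbol_zero_one (B C : E →L[ℂ] E) :
    Commute (affineSymbol B C) (affineSymbol 0 1) := by
  ext1 t
  rw [ContinuousMap.mul_apply, ContinuousMap.mul_apply, affineSymbol_zero_one_apply, mul_smul_comm,
    smul_mul_assoc, mul_one, one_mul]

/-- Comparing coefficients of `z`: the two commutator conditions say that the symbols commute. -/
theorem commute_affineSymbol {A₁ A₂ : E →L[ℂ] E} (h₁ : ⁅A₁, A₂⁆ = 0)
    (h₂ : ⁅A₁†, A₁⁆ = ⁅A₂†, A₂⁆) :
    Commute (affineSymbol (A₁†) A₂) (affineSymbol (A₂†) A₁) := by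
  rw [Ring.lie_def, sub_eq_zero] at h₁
  rw [Ring.lie_def, Ring.lie_def] at h₂
  have h₁' : A₁† * A₂† = A₂† * A₁† := by
    have := congrArg star h₁
    rw [star_mul, star_mul] at this
    exact this.symm
  ext1 t
  rw [ContinuousMap.mul_apply, ContinuousMap.mul_apply, affineSymbol_apply, affineSymbol_apply]
  set z : ℂ := fourier 1 t
  have e : A₁† * A₁ + A₂ * A₂† = A₂† * A₂ + A₁ * A₁† := by
    rw [sub_eq_sub_iff_add_eq_add] at h₂
    exact h₂
  calc (A₁† + z • A₂) * (A₂† + z • A₁)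
      = A₁† * A₂† + z • (A₁† * A₁ + A₂ * A₂†) + z • z • (A₂ * A₁) := by
        simp only [add_mul, mul_add, smul_mul_assoc, mul_smul_comm, smul_add]
        abel
    _ = A₂† * A₁† + z • (A₂† * A₂ + A₁ * A₁†) + z • z • (A₁ * A₂) := by rw [h₁', e, h₁]
    _ = _ := by
        simp only [add_mul, mul_add, smul_mul_assoc, mul_smul_comm, smul_add]
        abel

theorem norm_affineSymbol_le {B C : E →L[ℂ] E} (h : ∀ z : ℂ, ‖z‖ < 1 → ‖B + z • C‖ ≤ 1)
    (t : UnitAddCircle) : ‖affineSymbol B C t‖ ≤ 1 := by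
  have hc : IsClosed {z : ℂ | ‖B + z • C‖ ≤ 1} := isClosed_le (by fun_prop) continuous_const
  have hsub : Metric.ball (0 : ℂ) 1 ⊆ {z : ℂ | ‖B + z • C‖ ≤ 1} := fun z hz =>
    h z (mem_ball_zero_iff.1 hz)
  have := hc.closure_subset_iff.2 hsub
  rw [closure_ball _ one_ne_zero] at this
  exact this (mem_closedBall_zero_iff.2 (Circle.norm_coe _).le)

/-- The model triple is the restriction to `H²(E)` of the multiplication operators on `L²(E)` with
the same symbols, which form an `𝔼`-unitary. -/
theorem isPureEIsometry_toeplitz {A₁ A₂ : E →L[ℂ] E} (h₁ : ⁅A₁, A₂⁆ = 0)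
    (h₂ : ⁅A₁†, A₁⁆ = ⁅A₂†, A₂⁆) (h₃ : ∀ z : ℂ, ‖z‖ < 1 → ‖A₁† + z • A₂‖ ≤ 1) :
    IsPureEIsometry (toeplitz (affineSymbol (A₁†) A₂)) (toeplitz (affineSymbol (A₂†) A₁))
      (toeplitzZ (E := E)) := by
  have hN : CommutingTriple (multOp (affineSymbol (A₁†) A₂)) (multOp (affineSymbol (A₂†) A₁))
      (multOp (affineSymbol 0 1)) := by
    refine ⟨?_, ?_, ?_⟩
    · rw [← multOp_mul, ← multOp_mul, (commute_affineSymbol h₁ h₂).eq]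
    · rw [← multOp_mul, ← multOp_mul, (commute_affineSymbol_zero_one _ _).eq]
    · rw [← multOp_mul, ← multOp_mul, (commute_affineSymbol_zero_one _ _).eq]
  have comm {B C B' C' : E →L[ℂ] E} (h : multOp (affineSymbol B C) * multOp (affineSymbol B' C') =
      multOp (affineSymbol B' C') * multOp (affineSymbol B C)) :
      toeplitz (affineSymbol B C) * toeplitz (affineSymbol B' C') =
        toeplitz (affineSymbol B' C') * toeplitz (affineSymbol B C) := by
    ext1 f
    refine Subtype.ext ?_
    rw [mul_apply_eq_comp, mul_apply_eq_comp, coe_toeplitz_affineSymbol, coe_toeplitz_affineSymbol,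
      coe_toeplitz_affineSymbol, coe_toeplitz_affineSymbol]
    exact DFunLike.congr_fun h _
  refine ⟨⟨⟨comm hN.comm₁₂, comm hN.comm₁₃, comm hN.comm₂₃⟩, LTwo E, inferInstance, inferInstance,
    inferInstance, (hardySpace E).subtypeₗᵢ, multOp (affineSymbol (A₁†) A₂),
    multOp (affineSymbol (A₂†) A₁), multOp (affineSymbol 0 1), ?_, fun f =>
      ⟨(coe_toeplitz_affineSymbol _ _ f).symm, (coe_toeplitz_affineSymbol _ _ f).symm,
        (coe_toeplitz_affineSymbol _ _ f).symm⟩⟩, isPureIsometry_toeplitzZ⟩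
  refine isEUnitary_of_relations hN ?_ ?_ ?_ ?_
  · rw [← multOp_star, ← multOp_mul, ← affineSymbol_eq_star_mul]
  · rw [← multOp_star, ← multOp_mul, star_affineSymbol_mul_self, multOp_one]
  · rw [← multOp_star, ← multOp_mul, affineSymbol_mul_star_self, multOp_one]
  · refine norm_multOp_le zero_le_one fun t => ?_
    rw [affineSymbol_eq_star_mul, ContinuousMap.mul_apply, ContinuousMap.star_apply,
      affineSymbol_zero_one_apply, mul_smul_comm, mul_one, norm_smul, norm_star]
    exact (mul_le_of_le_one_left (norm_nonneg _) (Circle.norm_coe _).le).trans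
      (norm_affineSymbol_le h₃ t)

end Model

/-! ### Relations between the operators of an `𝔼`-isometry -/

section Isometries

variable {H : Type u} [NormedAddCommGroup H] [InnerProductSpace ℂ H] [CompleteSpace H]

/-- Compressing the relations of an `𝔼`-unitary to an invariant subspace. -/
theorem IsEIsometry.relations {T₁ T₂ T₃ : H →L[ℂ] H} (h : IsEIsometry T₁ T₂ T₃) :
    T₁ = T₂† * T₃ ∧ T₂ = T₁† * T₃ ∧ ‖T₁‖ ≤ 1 := by
  obtain ⟨-, K, _, _, _, J, N₁, N₂, N₃, hN, hJ⟩ := h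
  obtain ⟨r₁, r₃, r₂⟩ := hN.relations
  have r₂' : N₂ = N₁† * N₃ := by
    have : N₁† = N₃† * N₂ := by
      rw [r₁]
      change star (star N₂ * N₃) = star N₃ * N₂
      rw [star_mul, star_star]
    rw [this, mul_assoc, hN.commuting.comm₂₃, ← mul_assoc, r₃, one_mul]
  refine ⟨?_, ?_, ?_⟩
  · ext1 x
    refine ext_inner_right ℂ fun y => ?_
    rw [mul_apply_eq_comp, ContinuousLinearMap.adjoint_inner_left, ← J.inner_map_map,
      ← J.inner_map_map (T₃ x), ← (hJ x).1, ← (hJ x).2.2, ← (hJ y).2.1,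
      ← ContinuousLinearMap.adjoint_inner_left, r₁, mul_apply_eq_comp]
  · ext1 x
    refine ext_inner_right ℂ fun y => ?_
    rw [mul_apply_eq_comp, ContinuousLinearMap.adjoint_inner_left, ← J.inner_map_map,
      ← J.inner_map_map (T₃ x), ← (hJ x).2.1, ← (hJ x).2.2, ← (hJ y).1,
      ← ContinuousLinearMap.adjoint_inner_left N₁]
    conv_lhs => rw [r₂', mul_apply_eq_comp]
  · refine ContinuousLinearMap.opNorm_le_bound _ zero_le_one fun x => ?_
    rw [one_mul, ← J.norm_map, ← (hJ x).1, r₁, mul_apply_eq_comp, ← J.norm_map x,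
      ← (ContinuousLinearMap.norm_map_iff_adjoint_comp_self N₃).2 r₃ (J x)]
    refine ((N₂†).le_of_opNorm_le ?_ _).trans_eq (one_mul _)
    rwa [LinearIsometryEquiv.norm_map]

end Isometries

/-! ### The defect space of a co-isometry -/

section Defect

variable {H : Type u} [NormedAddCommGroup H] [InnerProductSpace ℂ H] [CompleteSpace H]
  {V T₁ T₂ : H →L[ℂ] H}

theorem defectOp_adjoint (hV : V† * V = 1) : defectOp (V†) = 1 - V * V† := by
  have hp : (1 - V * V†) * (1 - V * V†) = 1 - V * V† := by
    have : V * V† * (V * V†) = V * V† := by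
      rw [mul_assoc, ← mul_assoc (V†), hV, one_mul]
    rw [mul_sub, sub_mul, sub_mul, this]
    simp
  have hs : star (1 - V * V†) = 1 - V * V† := by
    rw [star_sub, star_one, star_mul, ContinuousLinearMap.star_eq_adjoint,
      ContinuousLinearMap.star_eq_adjoint, ContinuousLinearMap.adjoint_adjoint]
  have h0 : 0 ≤ 1 - V * V† := by
    rw [← hp]
    nth_rw 1 [← hs]
    exact star_mul_self_nonneg _
  rw [defectOp, ContinuousLinearMap.adjoint_adjoint]
  exact CFC.sqrt_unique hp h0

theorem adjoint_apply_of_mem_defectSpace (hV : V† * V = 1) {x : H} (hx : x ∈ defectSpace (V†)) :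
    (V†) x = 0 := by
  refine Submodule.topologicalClosure_minimal (t := LinearMap.ker (V† : H →ₗ[ℂ] H)) _ ?_
    (ContinuousLinearMap.isClosed_ker (V†)) hx
  rintro _ ⟨y, rfl⟩
  have : (V†) (V ((V†) y)) = (V†) y := DFunLike.congr_fun hV _
  simp [defectOp_adjoint hV, this]

theorem defectOp_apply_of_adjoint_eq_zero (hV : V† * V = 1) {x : H} (hx : (V†) x = 0) :
    defectOp (V†) x = x := by
  simp [defectOp_adjoint hV, hx]

theorem mem_defectSpace_of_adjoint_eq_zero (hV : V† * V = 1) {x : H} (hx : (V†) x = 0) :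
    x ∈ defectSpace (V†) :=
  Submodule.le_topologicalClosure _ ⟨x, defectOp_apply_of_adjoint_eq_zero hV hx⟩

/-- The defect space of `V*` is the wandering space `ker V*` of the isometry `V`. -/
theorem mem_defectSpace_adjoint_iff (hV : V† * V = 1) (x : H) :
    x ∈ defectSpace (V†) ↔ (V†) x = 0 :=
  ⟨adjoint_apply_of_mem_defectSpace hV, mem_defectSpace_of_adjoint_eq_zero hV⟩

theorem defectOp_coe (hV : V† * V = 1) (w : defectSpace (V†)) : defectOp (V†) w = w :=
  defectOp_apply_of_adjoint_eq_zero hV (adjoint_apply_of_mem_defectSpace hV w.2)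

/-- The defining equation of a fundamental operator says that it is a restriction, because the
defect operator is the projection onto the defect space. -/
theorem comp_defectOp_eq_iff (hV : V† * V = 1) {S : H →L[ℂ] H}
    {A : defectSpace (V†) →L[ℂ] defectSpace (V†)} :
    S ∘L defectOp (V†) =
        defectOp (V†) ∘L (defectSpace (V†)).subtypeL ∘L A ∘L defectMap (V†) ↔
      ∀ w : defectSpace (V†), (A w : H) = S w := by
  have e (x : H) : (defectOp (V†) ∘L (defectSpace (V†)).subtypeL ∘L A ∘L defectMap (V†)) x =
      A (defectMap (V†) x) := defectOp_coe hV _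
  constructor
  · intro h w
    have hw := DFunLike.congr_fun h (w : H)
    have hm : defectMap (V†) (w : H) = w := Subtype.ext (defectOp_coe hV w)
    rw [e, hm] at hw
    rw [← hw, ContinuousLinearMap.comp_apply, defectOp_coe hV]
  · intro h
    ext1 x
    rw [e, h]
    rfl

theorem areFundamentalOperators_iff (hV : V† * V = 1) (h₁ : T₁ = T₂† * V) (h₂ : T₂ = T₁† * V)
    {A₁ A₂ : defectSpace (V†) →L[ℂ] defectSpace (V†)} :
    AreFundamentalOperators (T₁†) (T₂†) (V†) A₁ A₂ ↔
      (∀ w : defectSpace (V†), (A₁ w : H) = (T₁†) w) ∧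
        ∀ w : defectSpace (V†), (A₂ w : H) = (T₂†) w := by
  rw [AreFundamentalOperators, ContinuousLinearMap.adjoint_adjoint,
    ContinuousLinearMap.adjoint_adjoint, ← comp_defectOp_eq_iff hV, ← comp_defectOp_eq_iff hV]
  have e₁ : T₁† - T₂ ∘L V† = T₁† ∘L defectOp (V†) := by
    change T₁† - T₂ * V† = T₁† * defectOp (V†)
    rw [defectOp_adjoint hV, mul_sub, mul_one, ← mul_assoc, ← h₂]
  have e₂ : T₂† - T₁ ∘L V† = T₂† ∘L defectOp (V†) := by
    change T₂† - T₁ * V† = T₂† * defectOp (V†)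
    rw [defectOp_adjoint hV, mul_sub, mul_one, ← mul_assoc, ← h₁]
  rw [e₁, e₂]

theorem adjoint_mul_comm {S T : H →L[ℂ] H} (h : S * T = T * S) : S† * T† = T† * S† := by
  have := congrArg star h
  rw [star_mul, star_mul] at this
  exact this.symm

theorem adjoint_mapsTo_defectSpace (hV : V† * V = 1) (hc : T₁ * V = V * T₁)
    (w : defectSpace (V†)) : (T₁†) w ∈ defectSpace (V†) := by
  refine mem_defectSpace_of_adjoint_eq_zero hV ?_
  have := DFunLike.congr_fun (adjoint_mul_comm hc) (w : H)
  rw [mul_apply_eq_comp, mul_apply_eq_comp, adjoint_apply_of_mem_defectSpace hV w.2,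
    map_zero] at this
  exact this.symm

theorem existsUnique_fundamentalOperators (hV : V† * V = 1) (h₁ : T₁ = T₂† * V)
    (h₂ : T₂ = T₁† * V) (hc₁ : T₁ * V = V * T₁) (hc₂ : T₂ * V = V * T₂) :
    ∃! A : (defectSpace (V†) →L[ℂ] defectSpace (V†)) × (defectSpace (V†) →L[ℂ] defectSpace (V†)),
      AreFundamentalOperators (T₁†) (T₂†) (V†) A.1 A.2 := by
  refine ⟨((T₁† ∘L (defectSpace (V†)).subtypeL).codRestrict _ (adjoint_mapsTo_defectSpace hV hc₁),
    (T₂† ∘L (defectSpace (V†)).subtypeL).codRestrict _ (adjoint_mapsTo_defectSpace hV hc₂)),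
    (areFundamentalOperators_iff hV h₁ h₂).2 ⟨fun w => rfl, fun w => rfl⟩, fun A hA => ?_⟩
  obtain ⟨a₁, a₂⟩ := (areFundamentalOperators_iff hV h₁ h₂).1 hA
  refine Prod.ext ?_ ?_ <;> ext w
  · exact a₁ w
  · exact a₂ w

end Defect

/-! ### Properties of the fundamental operators -/

section Fundamental

variable {H : Type u} [NormedAddCommGroup H] [InnerProductSpace ℂ H] [CompleteSpace H]
  {V T₁ T₂ : H →L[ℂ] H} {W : Submodule ℂ H} {A₁ A₂ : W →L[ℂ] W}

theorem lie_fundamentalOperators (hc : T₁ * T₂ = T₂ * T₁)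
    (a₁ : ∀ w : W, (A₁ w : H) = (T₁†) w)
    (a₂ : ∀ w : W, (A₂ w : H) = (T₂†) w) : ⁅A₁, A₂⁆ = 0 := by
  rw [Ring.lie_def, sub_eq_zero]
  ext w
  rw [mul_apply_eq_comp, mul_apply_eq_comp, a₁, a₂, a₂, a₁]
  exact DFunLike.congr_fun (adjoint_mul_comm hc) _

variable [CompleteSpace W]

/-- On the wandering space `ker V*`, the operator `T₁` is `A₁* + V A₂`. -/
theorem apply_coe_wandering (hV : V† * V = 1) (hW : ∀ x, x ∈ W ↔ (V†) x = 0)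
    (h₁ : T₁ = T₂† * V) (hc₂ : T₂ * V = V * T₂)
    (a₁ : ∀ w : W, (A₁ w : H) = (T₁†) w)
    (a₂ : ∀ w : W, (A₂ w : H) = (T₂†) w) (w : W) :
    T₁ w = ((A₁†) w : H) + V (A₂ w) := by
  have e : V† * T₁ = T₂† := by
    rw [h₁, ← mul_assoc, ← adjoint_mul_comm hc₂, mul_assoc, hV, mul_one]
  have hu : T₁ w - V (A₂ w) ∈ W := by
    refine (hW _).2 ?_
    rw [map_sub, ← mul_apply_eq_comp, ← mul_apply_eq_comp, hV, e, a₂]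
    exact sub_self _
  have : (⟨_, hu⟩ : W) = (A₁†) w := by
    refine ext_inner_right ℂ fun y => ?_
    rw [ContinuousLinearMap.adjoint_inner_left, Submodule.coe_inner, Submodule.coe_inner, a₁,
      ContinuousLinearMap.adjoint_inner_right, inner_sub_left,
      ← ContinuousLinearMap.adjoint_inner_right V, (hW _).1 y.2,
      inner_zero_right, sub_zero]
  rw [← this]
  exact (sub_add_cancel _ _).symm

/-- Both `T₁* T₁` and `T₂* T₂` are equal to `T₁* T₂* V`; the components in `ker V*` of their values
on `ker V*` give the identity. -/
theorem lie_adjoint_fundamentalOperators (hV : V† * V = 1) (hW : ∀ x, x ∈ W ↔ (V†) x = 0)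
    (h₁ : T₁ = T₂† * V) (h₂ : T₂ = T₁† * V) (hc : T₁ * T₂ = T₂ * T₁) (hc₁ : T₁ * V = V * T₁)
    (hc₂ : T₂ * V = V * T₂) (a₁ : ∀ w : W, (A₁ w : H) = (T₁†) w)
    (a₂ : ∀ w : W, (A₂ w : H) = (T₂†) w) : ⁅A₁†, A₁⁆ = ⁅A₂†, A₂⁆ := by
  have f₁ := apply_coe_wandering hV hW h₁ hc₂ a₁ a₂
  have f₂ := apply_coe_wandering hV hW h₂ hc₁ a₂ a₁
  have e : T₁† * T₁ = T₂† * T₂ := by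
    calc T₁† * T₁ = T₁† * (T₂† * V) := by rw [← h₁]
      _ = T₂† * (T₁† * V) := by rw [← mul_assoc, adjoint_mul_comm hc, mul_assoc]
      _ = T₂† * T₂ := by rw [← h₂]
  have hA : A₁ * A₂ = A₂ * A₁ := sub_eq_zero.1 (lie_fundamentalOperators hc a₁ a₂)
  rw [Ring.lie_def, Ring.lie_def, sub_eq_sub_iff_add_eq_add]
  ext w
  have hAw : A₁ (A₂ w) = A₂ (A₁ w) := by rw [← mul_apply_eq_comp, hA, mul_apply_eq_comp]
  have t₁ : (T₁†) (T₁ w) = A₁ ((A₁†) w) + ((A₂†) (A₂ w) + V (A₁ (A₂ w))) := by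
    rw [f₁ w, ContinuousLinearMap.map_add, a₁, ← f₂ (A₂ w)]
    exact congrArg _ (DFunLike.congr_fun h₂ _).symm
  have t₂ : (T₂†) (T₂ w) = A₂ ((A₂†) w) + ((A₁†) (A₁ w) + V (A₂ (A₁ w))) := by
    rw [f₂ w, ContinuousLinearMap.map_add, a₂, ← f₁ (A₁ w)]
    exact congrArg _ (DFunLike.congr_fun h₁ _).symm
  have hw : (A₁ ((A₁†) w) : H) + (A₂†) (A₂ w) = A₂ ((A₂†) w) + (A₁†) (A₁ w) := by
    have hTw : (T₁†) (T₁ w) = (T₂†) (T₂ w) := DFunLike.congr_fun e (w : H)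
    rw [t₁, t₂, hAw, ← add_assoc, ← add_assoc] at hTw
    exact add_right_cancel hTw
  simp only [add_apply, mul_apply_eq_comp, Submodule.coe_add]
  rw [add_comm, ← hw, add_comm]

/-- The vectors `f = ∑ aⁿ Vⁿ x` with `x ∈ ker V*`, which solve `f = x + a V f`, are scaled isometric
images of `x`. -/
theorem norm_sq_of_eq_add_smul (hV : V† * V = 1) {a : ℂ} {x f : H} (hx : (V†) x = 0)
    (hf : f = x + a • V f) : (1 - ‖a‖ ^ 2) * ‖f‖ ^ 2 = ‖x‖ ^ 2 := by
  have h0 : ⟪x, a • V f⟫_ℂ = 0 := by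
    rw [inner_smul_right, ← ContinuousLinearMap.adjoint_inner_left, hx, inner_zero_left, mul_zero]
  have h1 := norm_add_sq_eq_norm_sq_add_norm_sq_of_inner_eq_zero x (a • V f) h0
  rw [← hf, norm_smul, (ContinuousLinearMap.norm_map_iff_adjoint_comp_self V).2 hV] at h1
  linarith

theorem norm_adjoint_add_smul {E : Type*} [NormedAddCommGroup E] [InnerProductSpace ℂ E]
    [CompleteSpace E] (B C : E →L[ℂ] E) (z : ℂ) : ‖B† + z • C‖ = ‖B + conj z • C†‖ := by
  have e : B† + z • C = star (B + conj z • C†) := by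
    rw [star_add, star_smul, ContinuousLinearMap.star_eq_adjoint,
      ContinuousLinearMap.star_eq_adjoint, ContinuousLinearMap.adjoint_adjoint, RCLike.star_def,
      RCLike.conj_conj]
  rw [e, norm_star]

/-- The vectors `∑ aⁿ Vⁿ x` correspond to reproducing kernels of `H²`, and `T₁*` maps the kernel
with coefficient `x` to the one with coefficient `(A₁ + a A₂*) x`. Hence `A₁ + a A₂*` inherits
the norm bound of `T₁*`. -/
theorem norm_adjoint_add_smul_le (hV : V† * V = 1) (hW : ∀ x, x ∈ W ↔ (V†) x = 0)
    (h₂ : T₂ = T₁† * V) (hc₁ : T₁ * V = V * T₁) (hc₂ : T₂ * V = V * T₂) (hT : ‖T₁‖ ≤ 1)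
    (a₁ : ∀ w : W, (A₁ w : H) = (T₁†) w)
    (a₂ : ∀ w : W, (A₂ w : H) = (T₂†) w) {z : ℂ} (hz : ‖z‖ < 1) :
    ‖A₁† + z • A₂‖ ≤ 1 := by
  have f₂ := apply_coe_wandering hV hW h₂ hc₁ a₂ a₁
  set a := conj z with ha
  have ha1 : ‖a‖ < 1 := by rwa [ha, RCLike.norm_conj]
  rw [norm_adjoint_add_smul, ← ha]
  refine ContinuousLinearMap.opNorm_le_bound _ zero_le_one fun x => ?_
  rw [one_mul]
  have hVn : ‖V‖ ≤ 1 := ContinuousLinearMap.opNorm_le_bound _ zero_le_one fun y => by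
    rw [(ContinuousLinearMap.norm_map_iff_adjoint_comp_self V).2 hV, one_mul]
  have hu : IsUnit (1 - a • V) := isUnit_one_sub_of_norm_lt_one (by
    rw [norm_smul]
    exact (mul_le_of_le_one_right (norm_nonneg _) hVn).trans_lt ha1)
  obtain ⟨f, hf⟩ : ∃ f : H, f = x + a • V f := by
    obtain ⟨u, hu⟩ := hu
    refine ⟨(↑u⁻¹ : H →L[ℂ] H) x, ?_⟩
    have : (1 - a • V) ((↑u⁻¹ : H →L[ℂ] H) x) = x := by
      rw [← hu, ← mul_apply_eq_comp, Units.mul_inv]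
      rfl
    exact sub_eq_iff_eq_add.1 this
  set y := (A₁ + a • A₂†) x with hy
  have hg : (T₁†) f = y + a • V ((T₁†) f) := by
    have e₁ : (T₁†) f = A₁ x + a • T₂ f := by
      conv_lhs => rw [hf]
      rw [map_add, map_smul, a₁, ← mul_apply_eq_comp (T₁†) V, ← h₂]
    have e₂ : T₂ f = ((A₂†) x : H) + V (A₁ x) + a • V (T₂ f) := by
      conv_lhs => rw [hf]
      rw [map_add, map_smul, f₂, ← mul_apply_eq_comp T₂ V, hc₂, mul_apply_eq_comp]
    rw [e₁]
    conv_lhs => rw [e₂]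
    simp only [hy, add_apply, smul_apply, Submodule.coe_add, Submodule.coe_smul, map_add, map_smul]
    module
  have n₁ := norm_sq_of_eq_add_smul hV ((hW _).1 x.2) hf
  have n₂ := norm_sq_of_eq_add_smul hV ((hW _).1 y.2) hg
  have n₃ : ‖(T₁†) f‖ ≤ ‖f‖ :=
    ((T₁†).le_of_opNorm_le (by rwa [LinearIsometryEquiv.norm_map]) f).trans_eq (one_mul _)
  have ha2 : 0 ≤ 1 - ‖a‖ ^ 2 := by nlinarith [norm_nonneg a]
  refine le_of_sq_le_sq ?_ (norm_nonneg _)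
  rw [← Submodule.norm_coe, ← Submodule.norm_coe, ← n₁, ← n₂]
  gcongr

end Fundamental

/-! ### The model of a pure isometry -/

section Wold

variable {H : Type u} [NormedAddCommGroup H] [InnerProductSpace ℂ H] [CompleteSpace H]
  {V : H →L[ℂ] H} {W : Submodule ℂ H}

theorem norm_pow_apply (hV : V† * V = 1) (n : ℕ) (x : H) : ‖(V ^ n) x‖ = ‖x‖ := by
  induction n with
  | zero => simp
  | succ n ih =>
    rw [pow_succ', mul_apply_eq_comp, (ContinuousLinearMap.norm_map_iff_adjoint_comp_self V).2 hV,
      ih]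

/-- The isometric embedding `x ↦ Vⁿ x` of a subspace `W`, in the applications the wandering space
`ker V*` of the isometry `V`. -/
noncomputable def wandering (W : Submodule ℂ H) (hV : V† * V = 1) (n : ℕ) : W →ₗᵢ[ℂ] H where
  toLinearMap := (V ^ n : H →L[ℂ] H).toLinearMap ∘ₗ W.subtype
  norm_map' x := norm_pow_apply hV n x

theorem wandering_apply (hV : V† * V = 1) (n : ℕ) (x : W) :
    wandering W hV n x = (V ^ n) x := rfl

theorem orthogonalFamily_wandering (hV : V† * V = 1) (hW : ∀ x, x ∈ W ↔ (V†) x = 0) :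
    OrthogonalFamily ℂ (fun _ : ℕ => W) (wandering W hV) := by
  have key (i k : ℕ) (x y : W) :
      ⟪wandering W hV i x, wandering W hV (i + k + 1) y⟫_ℂ = 0 := by
    have := (LinearIsometry.mk (V ^ i : H →L[ℂ] H).toLinearMap (norm_pow_apply hV i)).inner_map_map
      (x : H) ((V ^ (k + 1)) y)
    rw [wandering_apply, wandering_apply, add_assoc, pow_add, mul_apply_eq_comp]
    refine this.trans ?_
    rw [pow_succ', mul_apply_eq_comp, ← ContinuousLinearMap.adjoint_inner_left,
      (hW _).1 x.2, inner_zero_left]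
  intro i j hij x y
  rcases hij.lt_or_gt with h | h
  · obtain ⟨k, rfl⟩ := Nat.exists_eq_add_of_lt h
    exact key i k x y
  · obtain ⟨k, rfl⟩ := Nat.exists_eq_add_of_lt h
    rw [← inner_conj_symm, key j k y x, map_zero]

/-- A vector `f` orthogonal to all `Vⁿ ker V*` satisfies `‖V*ⁿ f‖ = ‖f‖` for all `n`, hence vanishes
when `V` is pure. -/
theorem dense_iSup_range_wandering (hV : V† * V = 1) (hW : ∀ x, x ∈ W ↔ (V†) x = 0)
    (hp : ∀ x, Tendsto (fun n : ℕ => ((V†) ^ n) x) atTop (𝓝 0)) :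
    ⊤ ≤ (⨆ n, LinearMap.range (wandering W hV n).toLinearMap).topologicalClosure := by
  rw [top_le_iff, Submodule.topologicalClosure_eq_top_iff, Submodule.eq_bot_iff]
  intro f hf
  have key (n : ℕ) : ((V†) ^ n) f = V (((V†) ^ (n + 1)) f) := by
    set g := ((V†) ^ n) f with hg
    have hgV : ((V†) ^ (n + 1)) f = (V†) g := by rw [pow_succ', mul_apply_eq_comp]
    have hg0 : (V†) (g - V ((V†) g)) = 0 := by
      rw [map_sub, ← mul_apply_eq_comp (V†) V, hV]
      exact sub_self _
    have hperp : ⟪g, g - V ((V†) g)⟫_ℂ = 0 := by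
      have h1 := hf _ (Submodule.mem_iSup_of_mem n
        ⟨⟨_, (hW _).2 hg0⟩, rfl⟩)
      have h2 : ⟪(V ^ n) (g - V ((V†) g)), f⟫_ℂ = 0 := h1
      rw [← ContinuousLinearMap.adjoint_inner_right] at h2
      have h3 : (V ^ n)† = (V†) ^ n := star_pow V n
      rw [h3, ← hg] at h2
      rw [← inner_conj_symm, h2, map_zero]
    have hself : ⟪g - V ((V†) g), g - V ((V†) g)⟫_ℂ = 0 := by
      rw [inner_sub_left, hperp, ← ContinuousLinearMap.adjoint_inner_right, hg0, inner_zero_right,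
        sub_zero]
    rw [hgV]
    exact sub_eq_zero.1 (inner_self_eq_zero.1 hself)
  have hn (n : ℕ) : ‖((V†) ^ n) f‖ = ‖f‖ := by
    induction n with
    | zero => simp
    | succ n ih =>
      rw [← ih, key n, (ContinuousLinearMap.norm_map_iff_adjoint_comp_self V).2 hV]
  have h0 := (hp f).norm
  simp only [hn, norm_zero] at h0
  exact norm_eq_zero.1 (tendsto_nhds_unique tendsto_const_nhds h0)

/-- Operators that agree on the vectors `Vⁿ x` with `x ∈ ker V*` are equal. -/
theorem ext_wandering (hV : V† * V = 1) (hW : ∀ x, x ∈ W ↔ (V†) x = 0)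
    (hp : ∀ x, Tendsto (fun n : ℕ => ((V†) ^ n) x) atTop (𝓝 0)) {F : Type*}
    [NormedAddCommGroup F] [NormedSpace ℂ F] {S T : H →L[ℂ] F}
    (h : ∀ n x, S (wandering W hV n x) = T (wandering W hV n x)) : S = T := by
  have hle : (⨆ n, LinearMap.range (wandering W hV n).toLinearMap) ≤
      LinearMap.ker ((S - T : H →L[ℂ] F) : H →ₗ[ℂ] F) := by
    refine iSup_le fun n => ?_
    rintro _ ⟨x, rfl⟩
    exact sub_eq_zero.2 (h n x)
  have := Submodule.topologicalClosure_minimal _ hle (ContinuousLinearMap.isClosed_ker (S - T))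
  ext1 x
  exact sub_eq_zero.1 (this (dense_iSup_range_wandering hV hW hp (Submodule.mem_top (x := x))))

variable [CompleteSpace W]

theorem isHilbertSum_wandering (hV : V† * V = 1) (hW : ∀ x, x ∈ W ↔ (V†) x = 0)
    (hp : ∀ x, Tendsto (fun n : ℕ => ((V†) ^ n) x) atTop (𝓝 0)) :
    IsHilbertSum ℂ (fun _ : ℕ => W) (wandering W hV) :=
  .mk (orthogonalFamily_wandering hV hW) (dense_iSup_range_wandering hV hW hp)

/-- The unitary `Vⁿ x ↦ zⁿ x` from the space of a pure isometry onto the Hardy space of its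
wandering space. -/
noncomputable def hardyEquiv (hV : V† * V = 1) (hW : ∀ x, x ∈ W ↔ (V†) x = 0)
    (hp : ∀ x, Tendsto (fun n : ℕ => ((V†) ^ n) x) atTop (𝓝 0)) :
    H ≃ₗᵢ[ℂ] hardySpace (W) :=
  (isHilbertSum_wandering hV hW hp).linearIsometryEquiv.trans
    (isHilbertSum_hardyMonomial (E := W)).linearIsometryEquiv.symm

theorem hardyEquiv_wandering (hV : V† * V = 1) (hW : ∀ x, x ∈ W ↔ (V†) x = 0)
    (hp : ∀ x, Tendsto (fun n : ℕ => ((V†) ^ n) x) atTop (𝓝 0)) (n : ℕ) (x : W) :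
    hardyEquiv hV hW hp (wandering W hV n x) = hardyMonomial _ n x := by
  rw [hardyEquiv, LinearIsometryEquiv.trans_apply,
    ← (isHilbertSum_wandering hV hW hp).linearIsometryEquiv_symm_apply_single,
    LinearIsometryEquiv.apply_symm_apply, IsHilbertSum.linearIsometryEquiv_symm_apply_single]

theorem hardyEquiv_coe (hV : V† * V = 1) (hW : ∀ x, x ∈ W ↔ (V†) x = 0)
    (hp : ∀ x, Tendsto (fun n : ℕ => ((V†) ^ n) x) atTop (𝓝 0)) (x : W) :
    (hardyEquiv hV hW hp x : LTwo W) = Lp.const 2 _ x := by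
  have h0 := hardyEquiv_wandering hV hW hp 0 x
  rw [wandering_apply, pow_zero] at h0
  exact (congrArg Subtype.val h0).trans (monomial_zero x)

/-- An operator that commutes with `V` and acts on `ker V*` as `B + V C` is unitarily equivalent to
the Toeplitz operator with symbol `B + z C`. -/
theorem eq_hardyEquiv_symm_toeplitz (hV : V† * V = 1) (hW : ∀ x, x ∈ W ↔ (V†) x = 0)
    (hp : ∀ x, Tendsto (fun n : ℕ => ((V†) ^ n) x) atTop (𝓝 0)) {T : H →L[ℂ] H}
    (hc : T * V = V * T) {B C : W →L[ℂ] W}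
    (hT : ∀ w : W, T w = (B w : H) + V (C w)) (h : H) :
    T h = (hardyEquiv hV hW hp).symm (toeplitz (affineSymbol B C) (hardyEquiv hV hW hp h)) := by
  rw [LinearIsometryEquiv.eq_symm_apply]
  let U : H →L[ℂ] hardySpace (W) := (hardyEquiv hV hW hp).toContinuousLinearEquiv
  have key : U ∘L T = toeplitz (affineSymbol B C) ∘L U := by
    refine ext_wandering hV hW hp fun n x => ?_
    change hardyEquiv hV hW hp (T (wandering W hV n x)) =
      toeplitz (affineSymbol B C) (hardyEquiv hV hW hp (wandering W hV n x))
    have e : T (wandering W hV n x) = wandering W hV n (B x) + wandering W hV (n + 1) (C x) := by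
      have hcn : T * V ^ n = V ^ n * T := (Commute.pow_right (show Commute T V from hc) n).eq
      rw [wandering_apply, wandering_apply, wandering_apply, ← mul_apply_eq_comp, hcn,
        mul_apply_eq_comp, hT, map_add, pow_succ, mul_apply_eq_comp]
    rw [e, (hardyEquiv hV hW hp).map_add, hardyEquiv_wandering, hardyEquiv_wandering,
      hardyEquiv_wandering, toeplitz_affineSymbol_hardyMonomial]
  exact DFunLike.congr_fun key h

end Wold

end Tetrablock

theorem theorem3p3 :
    -- the model of a pure `𝔼`-isometry
    (∀ (H : Type*) [NormedAddCommGroup H] [InnerProductSpace ℂ H] [CompleteSpace H]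
      (T₁ T₂ T₃ : H →L[ℂ] H), Tetrablock.IsPureEIsometry T₁ T₂ T₃ →
      -- the fundamental operators of the adjoint triple exist and are unique
      (∃! A : (Tetrablock.defectSpace (T₃†) →L[ℂ] Tetrablock.defectSpace (T₃†)) ×
          (Tetrablock.defectSpace (T₃†) →L[ℂ] Tetrablock.defectSpace (T₃†)),
        Tetrablock.AreFundamentalOperators (T₁†) (T₂†) (T₃†) A.1 A.2) ∧
      ∀ A₁ A₂ : Tetrablock.defectSpace (T₃†) →L[ℂ] Tetrablock.defectSpace (T₃†),
        Tetrablock.AreFundamentalOperators (T₁†) (T₂†) (T₃†) A₁ A₂ →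
        (∃ U : H ≃ₗᵢ[ℂ] Tetrablock.hardySpace (Tetrablock.defectSpace (T₃†)),
          -- on the defect space, `U` is the identification with the constant functions
          (∀ x : Tetrablock.defectSpace (T₃†),
            (U x : Tetrablock.LTwo (Tetrablock.defectSpace (T₃†))) = Lp.const 2 _ x) ∧
          (∀ h, T₁ h = U.symm (Tetrablock.toeplitz (Tetrablock.affineSymbol (A₁†) A₂) (U h))) ∧
          (∀ h, T₂ h = U.symm (Tetrablock.toeplitz (Tetrablock.affineSymbol (A₂†) A₁) (U h))) ∧
          (∀ h, T₃ h = U.symm (Tetrablock.toeplitzZ (U h)))) ∧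
        ⁅A₁, A₂⁆ = 0 ∧ ⁅A₁†, A₁⁆ = ⁅A₂†, A₂⁆ ∧ ∀ z : ℂ, ‖z‖ < 1 → ‖A₁† + z • A₂‖ ≤ 1) ∧
    -- the converse
    (∀ (E : Type*) [NormedAddCommGroup E] [InnerProductSpace ℂ E] [CompleteSpace E]
      (A₁ A₂ : E →L[ℂ] E), ⁅A₁, A₂⁆ = 0 → ⁅A₁†, A₁⁆ = ⁅A₂†, A₂⁆ →
      (∀ z : ℂ, ‖z‖ < 1 → ‖A₁† + z • A₂‖ ≤ 1) →
      Tetrablock.IsPureEIsometry (Tetrablock.toeplitz (Tetrablock.affineSymbol (A₁†) A₂))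
        (Tetrablock.toeplitz (Tetrablock.affineSymbol (A₂†) A₁)) Tetrablock.toeplitzZ) := by
  refine ⟨fun H _ _ _ T₁ T₂ T₃ hT => ?_, fun E _ _ _ A₁ A₂ h₁ h₂ h₃ =>
    Tetrablock.isPureEIsometry_toeplitz h₁ h₂ h₃⟩
  have hr := hT.1.relations
  have hc := hT.1.1
  have hp := hT.2.2
  have hV : T₃† * T₃ = 1 := (ContinuousLinearMap.norm_map_iff_adjoint_comp_self T₃).1
    ((AddMonoidHomClass.isometry_iff_norm T₃).1 hT.2.1)
  have hW := Tetrablock.mem_defectSpace_adjoint_iff hV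
  refine ⟨Tetrablock.existsUnique_fundamentalOperators hV hr.1 hr.2.1 hc.comm₁₃ hc.comm₂₃,
    fun A₁ A₂ hA => ?_⟩
  have ha := (Tetrablock.areFundamentalOperators_iff hV hr.1 hr.2.1).1 hA
  exact ⟨⟨Tetrablock.hardyEquiv hV hW hp, Tetrablock.hardyEquiv_coe hV hW hp,
    Tetrablock.eq_hardyEquiv_symm_toeplitz hV hW hp hc.comm₁₃
      (Tetrablock.apply_coe_wandering hV hW hr.1 hc.comm₂₃ ha.1 ha.2),
    Tetrablock.eq_hardyEquiv_symm_toeplitz hV hW hp hc.comm₂₃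
      (Tetrablock.apply_coe_wandering hV hW hr.2.1 hc.comm₁₃ ha.2 ha.1),
    Tetrablock.eq_hardyEquiv_symm_toeplitz hV hW hp rfl fun w => by simp⟩,
    Tetrablock.lie_fundamentalOperators hc.comm₁₂ ha.1 ha.2,
    Tetrablock.lie_adjoint_fundamentalOperators hV hW hr.1 hr.2.1 hc.comm₁₂ hc.comm₁₃ hc.comm₂₃
      ha.1 ha.2,
    fun z hz => Tetrablock.norm_adjoint_add_smul_le hV hW hr.2.1 hc.comm₁₃ hc.comm₂₃ hr.2.2
      ha.1 ha.2 hz⟩
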